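/- A frequency is a strictly increasing sequence $\lambda=(\lambda_n)_{n\ge 1}$ of non-negative reals tending to $+\infty$; a $\lambda$-Dirichlet series is a formal sum $D=\sum a_n e^{-\lambda_n s}$ with complex coefficients $a_n$. Put $L(\lambda)=\limsup_{N\to\infty}\frac{\log N}{\lambda_N}\in[0,\infty]$. Let $\mathcal{D}_\infty^{ext}(\lambda)$ be the space of all somewhere convergent $\lambda$-Dirichlet series $D$ whose limit function has a bounded holomorphic extension $f$ to $[\operatorname{Re}>0]$, with the norm $\|D\|_\infty=\sup_{\operatorname{Re}s>0}|f(s)|$, and let $\mathcal{D}_\infty(\lambda)$ be its subspace of all $D$ that converge on $[\operatorname{Re}>0]$. For a $\lambda$-Dirichlet series $D$ let $\sigma_c(D)\in[-\infty,\infty]$ be the infimum of all $\sigma\in\mathbb{R}$ such that $D$ converges on $[\operatorname{Re}>\sigma]$ and, if $D$ converges somewhere, let $\sigma_b^{ext}(D)$ be the infimum of all $\sigma\in\mathbb{R}$ such that the limit function of $D$ has a bounded holomorphic extension to $[\operatorname{Re}>\sigma]$. Consider the conditions (BC) there is $l>0$ such that for every $\delta>0$ there is $C>0$ with $\lambda_{n+1}-\lambda_n\ge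 Ce^{-(l+\delta)\lambda_n}$ for all $n$; (LC) for every $\delta>0$ there is $C>0$ with $\lambda_{n+1}-\lambda_n\ge Ce^{-e^{\delta\lambda_n}}$ for all $n$. Theorem. Let $\lambda$ be a frequency. If $L(\lambda)<\infty$, then $\mathcal{D}_\infty^{ext}(\lambda)$ is complete. The space $\mathcal{D}_\infty(\lambda)$ is a Banach space if one of the following conditions holds: 1) $\lambda$ is $\mathbb{Q}$-linearly independent; 2) $L(\lambda)=0$; 3) $\sigma_c(D)\le\sigma_b^{ext}(D)$ for every somewhere convergent $\lambda$-Dirichlet series $D$, and $L(\lambda)<\infty$. In particular, condition 3) holds (and hence $\mathcal{D}_\infty(\lambda)$ is a Banach space) if $\lambda$ satisfies 3.1) (BC), or 3.2) (LC) and $L(\lambda)<\infty$. Moreover, none of the stated conditions is necessary for completeness: there is a frequency with $L(\lambda)=\infty$ for which $\mathcal{D}_\infty^{ext}(\lambda)$ is complete; and for each of the conditions 1), 2), 3), 3.1), 3.2), and also for (LC) and for $L(\lambda)<\infty$ on their own, there is a frequency $\lambda$ that violates it although $\mathcal{D}_\infty(\lambda)$ is complete. -/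

import Mathlib

open Filter Topology

/-- A frequency: a strictly increasing sequence of non-negative reals tending to `+∞`.
The sequence is indexed from `0`, so `lam.seq n` is the `(n+1)`-st frequency. -/
structure Frequency where
  seq : ℕ → ℝ
  strictMono : StrictMono seq
  nonneg : ∀ n, 0 ≤ seq n
  tendsto_atTop : Tendsto seq atTop atTop

namespace Frequency

/-- Partial sums of the Dirichlet series `∑ aₙ exp(-λₙ s)`; a `λ`-Dirichlet series is identified
with its sequence of coefficients `a : ℕ → ℂ`. -/
noncomputable def partialSum (lam : Frequency) (a : ℕ → ℂ) (s : ℂ) (N : ℕ) : ℂ :=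
  ∑ n ∈ Finset.range N, a n * Complex.exp (-(lam.seq n : ℂ) * s)

/-- The Dirichlet series with coefficients `a` converges at `s`. -/
def ConvergesAt (lam : Frequency) (a : ℕ → ℂ) (s : ℂ) : Prop :=
  ∃ z : ℂ, Tendsto (lam.partialSum a s) atTop (𝓝 z)

/-- `f` is a bounded holomorphic extension to `[Re > σ]` of the limit function of the Dirichlet
series with coefficients `a`: it is holomorphic and bounded there, and on some half-plane
`[Re > σ₀]` the series converges to `f`. (In particular the series converges somewhere. Two
holomorphic functions on a half-plane that agree on a smaller half-plane are equal.) -/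
structure IsBoundedExtension (lam : Frequency) (a : ℕ → ℂ) (σ : ℝ) (f : ℂ → ℂ) : Prop where
  holo : DifferentiableOn ℂ f {s : ℂ | σ < s.re}
  bdd : ∃ C : ℝ, ∀ s : ℂ, σ < s.re → ‖f s‖ ≤ C
  agrees : ∃ σ₀ : ℝ, σ ≤ σ₀ ∧
    ∀ s : ℂ, σ₀ < s.re → Tendsto (lam.partialSum a s) atTop (𝓝 (f s))

/-- The abscissa of convergence `σ_c`. -/
noncomputable def sigmaC (lam : Frequency) (a : ℕ → ℂ) : EReal :=
  sInf {x : EReal | ∃ σ : ℝ, x = (σ : EReal) ∧ ∀ s : ℂ, σ < s.re → lam.ConvergesAt a s}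

/-- The abscissa `σ_b^ext` of bounded holomorphic extendability. -/
noncomputable def sigmaBExt (lam : Frequency) (a : ℕ → ℂ) : EReal :=
  sInf {x : EReal | ∃ σ : ℝ, x = (σ : EReal) ∧ ∃ f : ℂ → ℂ, lam.IsBoundedExtension a σ f}

/-- Every somewhere convergent `λ`-Dirichlet series satisfies `σ_c ≤ σ_b^ext`, that is, it
converges on every open half-plane to which its limit function extends as a bounded
holomorphic function. -/
def ConvergesWhereExtendable (lam : Frequency) : Prop :=
  ∀ a : ℕ → ℂ, (∃ s : ℂ, lam.ConvergesAt a s) → lam.sigmaC a ≤ lam.sigmaBExt a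

/-- `L(λ) = limsup log N / λ_N`, with `N` counted from `1`. -/
noncomputable def L (lam : Frequency) : EReal :=
  limsup (fun N : ℕ => ((Real.log ((N : ℝ) + 1) / lam.seq N : ℝ) : EReal)) atTop

/-- Bohr's condition. -/
def BC (lam : Frequency) : Prop :=
  ∃ l : ℝ, 0 < l ∧ ∀ δ : ℝ, 0 < δ → ∃ C : ℝ, 0 < C ∧
    ∀ n : ℕ, C * Real.exp (-(l + δ) * lam.seq n) ≤ lam.seq (n + 1) - lam.seq n

/-- Landau's condition. -/
def LC (lam : Frequency) : Prop :=
  ∀ δ : ℝ, 0 < δ → ∃ C : ℝ, 0 < C ∧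
    ∀ n : ℕ, C * Real.exp (-Real.exp (δ * lam.seq n)) ≤ lam.seq (n + 1) - lam.seq n

/-! ### The spaces -/

theorem partialSum_add (lam : Frequency) (a b : ℕ → ℂ) (s : ℂ) (N : ℕ) :
    lam.partialSum (a + b) s N = lam.partialSum a s N + lam.partialSum b s N := by
  simp [partialSum, add_mul, Finset.sum_add_distrib]

theorem partialSum_smul (lam : Frequency) (c : ℂ) (a : ℕ → ℂ) (s : ℂ) (N : ℕ) :
    lam.partialSum (c • a) s N = c * lam.partialSum a s N := by
  simp [partialSum, Finset.mul_sum, mul_assoc]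

theorem IsBoundedExtension.zero (lam : Frequency) (σ : ℝ) :
    lam.IsBoundedExtension 0 σ 0 where
  holo := differentiableOn_const 0
  bdd := ⟨0, fun s _ => by simp⟩
  agrees := ⟨σ, le_rfl, fun s _ => by
    have : lam.partialSum 0 s = fun _ => 0 := by funext N; simp [partialSum]
    rw [this]; exact tendsto_const_nhds⟩

theorem IsBoundedExtension.add {lam : Frequency} {a b : ℕ → ℂ} {σ : ℝ} {f g : ℂ → ℂ}
    (hf : lam.IsBoundedExtension a σ f) (hg : lam.IsBoundedExtension b σ g) :
    lam.IsBoundedExtension (a + b) σ (f + g) where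
  holo := hf.holo.add hg.holo
  bdd := by
    obtain ⟨C, hC⟩ := hf.bdd
    obtain ⟨C', hC'⟩ := hg.bdd
    exact ⟨C + C', fun s hs => (norm_add_le _ _).trans (add_le_add (hC s hs) (hC' s hs))⟩
  agrees := by
    obtain ⟨x, hx, h⟩ := hf.agrees
    obtain ⟨y, _, h'⟩ := hg.agrees
    refine ⟨max x y, hx.trans (le_max_left _ _), fun s hs => ?_⟩
    have := (h s ((le_max_left _ _).trans_lt hs)).add (h' s ((le_max_right _ _).trans_lt hs))
    exact this.congr fun N => (lam.partialSum_add a b s N).symm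

theorem IsBoundedExtension.smul {lam : Frequency} {a : ℕ → ℂ} {σ : ℝ} {f : ℂ → ℂ} (c : ℂ)
    (hf : lam.IsBoundedExtension a σ f) : lam.IsBoundedExtension (c • a) σ (c • f) where
  holo := hf.holo.const_smul c
  bdd := by
    obtain ⟨C, hC⟩ := hf.bdd
    refine ⟨‖c‖ * C, fun s hs => ?_⟩
    rw [Pi.smul_apply, norm_smul]
    exact mul_le_mul_of_nonneg_left (hC s hs) (norm_nonneg c)
  agrees := by
    obtain ⟨x, hx, h⟩ := hf.agrees
    refine ⟨x, hx, fun s hs => ?_⟩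
    exact ((h s hs).const_mul c).congr fun N => (lam.partialSum_smul c a s N).symm

/-- Uniqueness of the extension. -/
theorem IsBoundedExtension.unique {lam : Frequency} {a : ℕ → ℂ} {σ : ℝ} {f g : ℂ → ℂ}
    (hf : lam.IsBoundedExtension a σ f) (hg : lam.IsBoundedExtension a σ g) {s : ℂ}
    (hs : σ < s.re) : f s = g s := by
  have ho : IsOpen {s : ℂ | σ < s.re} := isOpen_lt continuous_const Complex.continuous_re
  have hc : IsPreconnected {s : ℂ | σ < s.re} := (convex_halfSpace_re_gt σ).isPreconnected
  obtain ⟨x, hx, h⟩ := hf.agrees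
  obtain ⟨y, _, h'⟩ := hg.agrees
  have hz : σ < (((max x y + 1 : ℝ) : ℂ)).re := by
    rw [Complex.ofReal_re]; linarith [le_max_left x y]
  refine (hf.holo.analyticOnNhd ho).eqOn_of_preconnected_of_eventuallyEq
    (hg.holo.analyticOnNhd ho) hc hz ?_ hs
  have ho' : IsOpen {s : ℂ | max x y < s.re} := isOpen_lt continuous_const Complex.continuous_re
  filter_upwards [ho'.mem_nhds (show max x y < (((max x y + 1 : ℝ) : ℂ)).re by
    rw [Complex.ofReal_re]; linarith)] with w hw
  exact tendsto_nhds_unique (h w ((le_max_left _ _).trans_lt hw))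
    (h' w ((le_max_right _ _).trans_lt hw))

/-- The coefficient sequences of the somewhere convergent `λ`-Dirichlet series that have a
bounded holomorphic extension to `[Re > 0]`. -/
def extSubmodule (lam : Frequency) : Submodule ℂ (ℕ → ℂ) where
  carrier := {a | ∃ f : ℂ → ℂ, lam.IsBoundedExtension a 0 f}
  zero_mem' := ⟨0, .zero lam 0⟩
  add_mem' := fun ⟨f, hf⟩ ⟨g, hg⟩ => ⟨f + g, hf.add hg⟩
  smul_mem' := fun c _ ⟨f, hf⟩ => ⟨c • f, hf.smul c⟩

/-- The space `D_∞^ext(λ)`. It is a separate type, so that it carries only the norm defined below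
and not the topology of pointwise convergence of the coefficients. -/
def DExt (lam : Frequency) : Type := lam.extSubmodule

noncomputable instance (lam : Frequency) : AddCommGroup lam.DExt :=
  inferInstanceAs (AddCommGroup lam.extSubmodule)

noncomputable instance (lam : Frequency) : Module ℂ lam.DExt :=
  inferInstanceAs (Module ℂ lam.extSubmodule)

namespace DExt

variable {lam : Frequency}

/-- The Dirichlet coefficients of `D`. -/
def coeff (D : lam.DExt) : ℕ → ℂ := D.1

/-- The (unique) bounded holomorphic extension of `D` to `[Re > 0]`. -/
noncomputable def ext (D : lam.DExt) : ℂ → ℂ := Classical.choose D.2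

theorem ext_spec (D : lam.DExt) : lam.IsBoundedExtension D.coeff 0 D.ext :=
  Classical.choose_spec D.2

theorem ext_add (D E : lam.DExt) {s : ℂ} (hs : 0 < s.re) :
    (D + E).ext s = D.ext s + E.ext s :=
  (D + E).ext_spec.unique (D.ext_spec.add E.ext_spec) hs

theorem ext_smul (c : ℂ) (D : lam.DExt) {s : ℂ} (hs : 0 < s.re) :
    (c • D).ext s = c * D.ext s :=
  (c • D).ext_spec.unique (D.ext_spec.smul c) hs

/-- `‖D‖_∞ = sup_{Re s > 0} |f(s)|`, where `f` is the extension of `D`. -/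
noncomputable instance : Norm lam.DExt :=
  ⟨fun D => ⨆ s : {s : ℂ // 0 < s.re}, ‖D.ext s‖⟩

theorem norm_def (D : lam.DExt) : ‖D‖ = ⨆ s : {s : ℂ // 0 < s.re}, ‖D.ext s‖ := rfl

theorem bddAbove (D : lam.DExt) :
    BddAbove (Set.range fun s : {s : ℂ // 0 < s.re} => ‖D.ext s‖) := by
  obtain ⟨C, hC⟩ := D.ext_spec.bdd
  exact ⟨C, by rintro _ ⟨s, rfl⟩; exact hC s s.2⟩

theorem norm_ext_le (D : lam.DExt) {s : ℂ} (hs : 0 < s.re) : ‖D.ext s‖ ≤ ‖D‖ :=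
  le_ciSup D.bddAbove ⟨s, hs⟩

theorem norm_le (D : lam.DExt) {C : ℝ} (h : ∀ s : ℂ, 0 < s.re → ‖D.ext s‖ ≤ C) : ‖D‖ ≤ C :=
  haveI : Nonempty {s : ℂ // 0 < s.re} := ⟨⟨1, by simp⟩⟩
  ciSup_le fun s => h s s.2

end DExt

theorem norm_sum_mul_sub_le {b : ℕ → ℂ} {c : ℕ → ℝ} {B : ℝ} (hc : Antitone c)
    (hb : ∀ N, ‖∑ n ∈ Finset.range N, b n‖ ≤ B) (N : ℕ) :
    ‖∑ n ∈ Finset.range N, b n * c n - (∑ n ∈ Finset.range N, b n) * c N‖ ≤ B * (c 0 - c N) := by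
  induction N with
  | zero => simp
  | succ N ih =>
    have e : ∑ n ∈ Finset.range (N + 1), b n * (c n : ℂ)
        - (∑ n ∈ Finset.range (N + 1), b n) * c (N + 1)
        = (∑ n ∈ Finset.range N, b n * (c n : ℂ) - (∑ n ∈ Finset.range N, b n) * c N)
          + (∑ n ∈ Finset.range (N + 1), b n) * ((c N - c (N + 1) : ℝ) : ℂ) := by
      simp only [Finset.sum_range_succ]; push_cast; ring
    rw [e]
    refine (norm_add_le _ _).trans ?_
    rw [norm_mul, Complex.norm_of_nonneg (sub_nonneg.2 (hc (Nat.le_succ N)))]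
    have := mul_le_mul_of_nonneg_right (hb (N + 1)) (sub_nonneg.2 (hc (Nat.le_succ N)))
    linarith

/-- A Dirichlet series whose sum vanishes on a half-plane has vanishing coefficients. -/
theorem coeff_eq_zero (lam : Frequency) (a : ℕ → ℂ) (x : ℝ)
    (h : ∀ s : ℂ, x < s.re → Tendsto (lam.partialSum a s) atTop (𝓝 0)) : a = 0 := by
  by_contra hne
  have hex : ∃ k, a k ≠ 0 := by
    by_contra! H
    exact hne (funext H)
  classical
  obtain ⟨m, hm, hmin⟩ : ∃ m, a m ≠ 0 ∧ ∀ j < m, a j = 0 :=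
    ⟨Nat.find hex, Nat.find_spec hex, fun j hj => by simpa using Nat.find_min hex hj⟩
  have hsum : ∀ (s : ℂ) (N : ℕ), lam.partialSum a s (m + 1 + N)
      = a m * Complex.exp (-(lam.seq m : ℂ) * s) + ∑ n ∈ Finset.range N,
        a (m + 1 + n) * Complex.exp (-(lam.seq (m + 1 + n) : ℂ) * s) := by
    intro s N
    rw [partialSum, Finset.sum_range_add, Finset.sum_range_succ, Finset.sum_eq_zero, zero_add]
    intro j hj
    rw [hmin j (Finset.mem_range.1 hj), zero_mul]
  have hshift : ∀ s : ℂ, x < s.re → Tendsto (fun N => ∑ n ∈ Finset.range N,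
      a (m + 1 + n) * Complex.exp (-(lam.seq (m + 1 + n) : ℂ) * s)) atTop
      (𝓝 (0 - a m * Complex.exp (-(lam.seq m : ℂ) * s))) := by
    intro s hs
    have h1 := ((h s hs).comp (tendsto_add_atTop_nat (m + 1))).sub_const
      (a m * Complex.exp (-(lam.seq m : ℂ) * s))
    refine h1.congr fun N => ?_
    rw [Function.comp_apply, Nat.add_comm N, hsum, add_sub_cancel_left]
  set y₀ : ℝ := x + 1 with hy₀
  obtain ⟨B, hB⟩ := (hshift (y₀ : ℂ) (by rw [Complex.ofReal_re]; linarith)).norm.bddAbove_range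
  have hB' : ∀ N, ‖∑ n ∈ Finset.range N,
      a (m + 1 + n) * Complex.exp (-(lam.seq (m + 1 + n) : ℂ) * (y₀ : ℂ))‖ ≤ B :=
    fun N => hB ⟨N, rfl⟩
  have key : ∀ y : ℝ, 0 ≤ y → ‖a m * Complex.exp (-(lam.seq m : ℂ) * (y₀ : ℂ))‖
      ≤ B * Real.exp (-((lam.seq (m + 1) - lam.seq m) * y)) := by
    intro y hy
    have hanti : Antitone fun n : ℕ => Real.exp (-((lam.seq (m + 1 + n) - lam.seq m) * y)) := by
      intro i j hij
      have := lam.strictMono.monotone (Nat.add_le_add_left hij (m + 1))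
      refine Real.exp_le_exp.2 (neg_le_neg (mul_le_mul_of_nonneg_right ?_ hy))
      linarith
    have hbound : ∀ N, ‖∑ n ∈ Finset.range N,
        a (m + 1 + n) * Complex.exp (-(lam.seq (m + 1 + n) : ℂ) * (y₀ : ℂ))
          * (Real.exp (-((lam.seq (m + 1 + n) - lam.seq m) * y)) : ℝ)‖
        ≤ B * Real.exp (-((lam.seq (m + 1) - lam.seq m) * y)) := by
      intro N
      have h1 := norm_sum_mul_sub_le hanti hB' N
      have h2 : ‖(∑ n ∈ Finset.range N,
          a (m + 1 + n) * Complex.exp (-(lam.seq (m + 1 + n) : ℂ) * (y₀ : ℂ)))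
            * (Real.exp (-((lam.seq (m + 1 + N) - lam.seq m) * y)) : ℝ)‖
          ≤ B * Real.exp (-((lam.seq (m + 1 + N) - lam.seq m) * y)) := by
        rw [norm_mul, Complex.norm_of_nonneg (Real.exp_pos _).le]
        exact mul_le_mul_of_nonneg_right (hB' N) (Real.exp_pos _).le
      have h3 := norm_le_norm_sub_add (∑ n ∈ Finset.range N,
        a (m + 1 + n) * Complex.exp (-(lam.seq (m + 1 + n) : ℂ) * (y₀ : ℂ))
          * (Real.exp (-((lam.seq (m + 1 + n) - lam.seq m) * y)) : ℝ))
        ((∑ n ∈ Finset.range N,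
          a (m + 1 + n) * Complex.exp (-(lam.seq (m + 1 + n) : ℂ) * (y₀ : ℂ)))
            * (Real.exp (-((lam.seq (m + 1 + N) - lam.seq m) * y)) : ℝ))
      simp only [Nat.add_zero] at h1
      linarith
    have hlim := ((hshift ((y₀ + y : ℝ) : ℂ) (by rw [Complex.ofReal_re]; linarith)).mul_const
      (Complex.exp ((lam.seq m : ℂ) * y))).norm
    have hval : ‖(0 - a m * Complex.exp (-(lam.seq m : ℂ) * ((y₀ + y : ℝ) : ℂ)))
        * Complex.exp ((lam.seq m : ℂ) * y)‖
        = ‖a m * Complex.exp (-(lam.seq m : ℂ) * (y₀ : ℂ))‖ := by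
      rw [zero_sub, neg_mul, norm_neg, mul_assoc, ← Complex.exp_add]
      congr 3
      push_cast; ring
    rw [hval] at hlim
    refine le_of_tendsto' hlim fun N => ?_
    refine le_trans (le_of_eq ?_) (hbound N)
    rw [Finset.sum_mul]
    congr 1
    refine Finset.sum_congr rfl fun n _ => ?_
    rw [mul_assoc, mul_assoc, Complex.ofReal_exp, ← Complex.exp_add, ← Complex.exp_add]
    congr 2
    push_cast; ring
  have hgap : 0 < lam.seq (m + 1) - lam.seq m := sub_pos.2 (lam.strictMono (Nat.lt_succ_self m))
  have hto : Tendsto (fun y : ℝ => B * Real.exp (-((lam.seq (m + 1) - lam.seq m) * y))) atTop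
      (𝓝 (B * 0)) :=
    (Real.tendsto_exp_neg_atTop_nhds_zero.comp (tendsto_id.const_mul_atTop hgap)).const_mul B
  have hle := ge_of_tendsto hto ((eventually_ge_atTop 0).mono key)
  rw [mul_zero] at hle
  exact (mul_ne_zero hm (Complex.exp_ne_zero _)) (norm_le_zero_iff.1 hle)

namespace DExt

variable {lam : Frequency}

theorem normCore : NormedSpace.Core ℂ lam.DExt where
  norm_nonneg D := Real.iSup_nonneg fun _ => norm_nonneg _
  norm_smul c D := by
    have e : (fun s : {s : ℂ // 0 < s.re} => ‖(c • D).ext s‖)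
        = fun s : {s : ℂ // 0 < s.re} => ‖c‖ * ‖D.ext s‖ :=
      funext fun s => by rw [ext_smul c D s.2, norm_mul]
    rw [norm_def, e, norm_def, Real.mul_iSup_of_nonneg (norm_nonneg c)]
  norm_triangle D E := norm_le _ fun s hs => by
    rw [ext_add D E hs]
    exact (norm_add_le _ _).trans (add_le_add (D.norm_ext_le hs) (E.norm_ext_le hs))
  norm_eq_zero_iff D := by
    constructor
    · intro hD
      obtain ⟨x, hx, h⟩ := D.ext_spec.agrees
      refine Subtype.ext (lam.coeff_eq_zero D.coeff x fun s hs => ?_)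
      have h0 : D.ext s = 0 :=
        norm_le_zero_iff.1 ((D.norm_ext_le (hx.trans_lt hs)).trans hD.le)
      simpa [h0] using h s hs
    · rintro rfl
      refine le_antisymm (norm_le _ fun s hs => ?_) (Real.iSup_nonneg fun _ => norm_nonneg _)
      have h0 := (0 : lam.DExt).ext_spec.unique (IsBoundedExtension.zero lam 0) hs
      simp [h0]

/-- `D_∞^ext(λ)` with `‖·‖_∞` is a normed space. -/
noncomputable instance : NormedAddCommGroup lam.DExt := NormedAddCommGroup.ofCore normCore

noncomputable instance : NormedSpace ℂ lam.DExt := NormedSpace.ofCore normCore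

end DExt

theorem ConvergesAt.add {lam : Frequency} {a b : ℕ → ℂ} {s : ℂ}
    (ha : lam.ConvergesAt a s) (hb : lam.ConvergesAt b s) : lam.ConvergesAt (a + b) s := by
  obtain ⟨z, hz⟩ := ha
  obtain ⟨w, hw⟩ := hb
  exact ⟨z + w, (hz.add hw).congr fun N => (lam.partialSum_add a b s N).symm⟩

/-- The space `D_∞(λ)`: the subspace of `D_∞^ext(λ)` (with the same norm) of all series that
converge on `[Re > 0]`. -/
def DInf (lam : Frequency) : Submodule ℂ lam.DExt where
  carrier := {D | ∀ s : ℂ, 0 < s.re → lam.ConvergesAt D.coeff s}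
  zero_mem' := fun s _ => ⟨0, by
    have : lam.partialSum (0 : lam.DExt).coeff s = fun _ => 0 := by
      funext N
      exact Finset.sum_eq_zero fun n _ => zero_mul _
    rw [this]; exact tendsto_const_nhds⟩
  add_mem' := fun hD hE s hs => ConvergesAt.add (hD s hs) (hE s hs)
  smul_mem' := fun c D hD s hs => by
    obtain ⟨z, hz⟩ := hD s hs
    exact ⟨c * z, (hz.const_mul c).congr fun N => (lam.partialSum_smul c D.coeff s N).symm⟩

end Frequency

/-! ### Abel summation -/

/-! All coefficient estimates come from one device. Average the extension `f` along a vertical line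
against an integrable kernel `K` whose Fourier transform vanishes at all but finitely many
frequencies. Far to the right, termwise integration turns `f` into the Dirichlet polynomial with
coefficients `a n * kernelHat K (lam.seq n)`; the identity theorem carries this to `[Re > 0]`, and
the polynomial is bounded by `sup |f|` times the `L¹`-norm of `K`
(`IsBoundedExtension.norm_sum_mul_kernelHat_le`). A series that merely converges somewhere has
partial sums of linear growth on vertical lines, so a general frequency needs a kernel with
integrable weight `1 + |t|`, such as Jackson's.

Three choices of kernel matter. A Jackson kernel modulated to one frequency gives `‖a n‖ ≤ ‖D‖`. A
trapezoid with its slope between two consecutive frequencies bounds the coefficient sums by the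
logarithm of the inverse relative gap. A Jackson kernel stretched to transform `1` reduces the
`ℚ`-independent case to trigonometric polynomials, where a Riesz product gives `∑ ‖a n‖ ≤ 2 ‖D‖`.

Completeness of `DExt` follows once some weighted sum `∑ ‖a n‖ exp (-σ λₙ)` is controlled by `‖D‖`
(`completeSpace_dExt_of_sum_le`): the limit function is then the sum of the series of limit
coefficients on `[Re > σ]`. Finite `L` provides such a `σ`, and independence allows `σ = 0`. For
`DInf` it suffices that every element of `DExt` converges on `[Re > 0]`: absolutely if `L = 0` or
under independence, by hypothesis in case 3). Under (LC) the logarithm is `O(exp (δ λₙ))`, and Abel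
summation gives convergence; (BC) implies both (LC) and `L < ⊤`.

Two examples refute necessity: a slowly growing independent frequency with `L = ⊤`, and the integers
doubled by extremely close neighbours. -/

theorem norm_one_sub_exp_neg_mul_le {w : ℂ} {ρ : ℝ} (hρ : 0 < ρ) (hw : ρ ≤ w.re) {x : ℝ}
    (hx : 0 ≤ x) :
    ‖1 - Complex.exp (-(x : ℂ) * w)‖ ≤ ‖w‖ / ρ * (1 - Real.exp (-(ρ * x))) := by
  have hd : ∀ y : ℝ, HasDerivAt (fun y : ℝ => 1 - Complex.exp (-(y : ℂ) * w))
      (w * Complex.exp (-(y : ℂ) * w)) y := by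
    intro y
    have h := ((((Complex.ofRealCLM.hasDerivAt (x := y)).neg.mul_const w).cexp).const_sub 1)
    refine h.congr_deriv ?_
    simp
    ring
  have hB : ∀ y : ℝ, HasDerivAt (fun y : ℝ => ‖w‖ / ρ * (1 - Real.exp (-(ρ * y))))
      (‖w‖ * Real.exp (-(ρ * y))) y := by
    intro y
    have h := ((((hasDerivAt_id y).const_mul ρ).neg.exp).const_sub 1).const_mul (‖w‖ / ρ)
    refine h.congr_deriv ?_
    simp only [id, mul_one, Pi.neg_apply]
    field_simp
  -- Both sides vanish at `0`, so it is enough to compare derivatives, that is, `exp (-y * w.re)`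
  -- with `exp (-ρ y)`.
  refine image_norm_le_of_norm_deriv_right_le_deriv_boundary (a := 0) (b := x)
    (fun y _ => (hd y).continuousAt.continuousWithinAt)
    (fun y _ => (hd y).hasDerivWithinAt) (by simp) hB ?_ ⟨hx, le_rfl⟩
  intro y hy
  rw [norm_mul, Complex.norm_exp]
  refine mul_le_mul_of_nonneg_left (Real.exp_le_exp.2 ?_) (norm_nonneg w)
  have := mul_le_mul_of_nonneg_right hw hy.1
  simp
  linarith

/-- The growth factor only lowers the decay rate from `w.re` to `w.re - δ`. The bound is a
difference of values at `a` and `b`, so it telescopes over consecutive frequencies whatever their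
gaps. -/
theorem exp_mul_norm_exp_sub_exp_le {w : ℂ} {δ a b : ℝ} (hδ : 0 ≤ δ) (hw : δ < w.re)
    (hab : a ≤ b) :
    Real.exp (δ * a) * ‖Complex.exp (-(a : ℂ) * w) - Complex.exp (-(b : ℂ) * w)‖
      ≤ ‖w‖ / (w.re - δ) *
        (Real.exp (-((w.re - δ) * a)) - Real.exp (-((w.re - δ) * b))) := by
  have h := norm_one_sub_exp_neg_mul_le (w := w) (ρ := w.re - δ) (sub_pos.2 hw) (by linarith)
    (sub_nonneg.2 hab)
  have e1 : Complex.exp (-(a : ℂ) * w) - Complex.exp (-(b : ℂ) * w)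
      = Complex.exp (-(a : ℂ) * w) * (1 - Complex.exp (-((b - a : ℝ) : ℂ) * w)) := by
    rw [mul_sub, ← Complex.exp_add, mul_one]; congr 2; push_cast; ring
  have e2 : Real.exp (δ * a) * ‖Complex.exp (-(a : ℂ) * w)‖
      = Real.exp (-((w.re - δ) * a)) := by
    rw [Complex.norm_exp, ← Real.exp_add]; congr 1; simp; ring
  rw [e1, norm_mul, ← mul_assoc, e2]
  refine (mul_le_mul_of_nonneg_left h (Real.exp_pos _).le).trans (le_of_eq ?_)
  have e3 : Real.exp (-((w.re - δ) * a)) * Real.exp (-((w.re - δ) * (b - a)))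
      = Real.exp (-((w.re - δ) * b)) := by
    rw [← Real.exp_add]; congr 1; ring
  rw [← e3]; ring

namespace Frequency

variable (lam : Frequency) (a : ℕ → ℂ)

theorem partialSum_shift (s w : ℂ) (N : ℕ) :
    lam.partialSum a (s + w) N
      = lam.partialSum (fun n => a n * Complex.exp (-(lam.seq n : ℂ) * s)) w N := by
  refine Finset.sum_congr rfl fun n _ => ?_
  rw [mul_assoc, ← Complex.exp_add]; congr 2; ring

theorem partialSum_by_parts (w : ℂ) (N : ℕ) :
    lam.partialSum a w (N + 1)
      = lam.partialSum a 0 (N + 1) * Complex.exp (-(lam.seq N : ℂ) * w)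
        + ∑ n ∈ Finset.range N, lam.partialSum a 0 (n + 1) *
          (Complex.exp (-(lam.seq n : ℂ) * w) - Complex.exp (-(lam.seq (n + 1) : ℂ) * w)) := by
  induction N with
  | zero => simp [partialSum]
  | succ N ih =>
    have h1 : lam.partialSum a w (N + 2) = lam.partialSum a w (N + 1)
        + a (N + 1) * Complex.exp (-(lam.seq (N + 1) : ℂ) * w) := Finset.sum_range_succ _ _
    have h2 : lam.partialSum a 0 (N + 2) = lam.partialSum a 0 (N + 1) + a (N + 1) := by
      simp [partialSum, Finset.sum_range_succ]
    rw [h1, ih, Finset.sum_range_succ, h2]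
    ring

variable {lam a}

theorem norm_partialSum_mul_exp_sub_le {B δ : ℝ} (hδ : 0 ≤ δ) {w : ℂ} (hw : δ < w.re)
    (h : ∀ n, ‖lam.partialSum a 0 (n + 1)‖ ≤ B * Real.exp (δ * lam.seq n)) (n : ℕ) :
    ‖lam.partialSum a 0 (n + 1) *
      (Complex.exp (-(lam.seq n : ℂ) * w) - Complex.exp (-(lam.seq (n + 1) : ℂ) * w))‖
      ≤ B * (‖w‖ / (w.re - δ)) * (Real.exp (-((w.re - δ) * lam.seq n))
          - Real.exp (-((w.re - δ) * lam.seq (n + 1)))) := by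
  have hB : 0 ≤ B := by
    have := (norm_nonneg _).trans (h 0)
    exact nonneg_of_mul_nonneg_left this (Real.exp_pos _)
  have h1 := exp_mul_norm_exp_sub_exp_le hδ hw (lam.strictMono.monotone (Nat.le_succ n))
  rw [norm_mul]
  calc _ ≤ B * Real.exp (δ * lam.seq n) * _ := mul_le_mul_of_nonneg_right (h n) (norm_nonneg _)
    _ = B * (Real.exp (δ * lam.seq n) * _) := mul_assoc _ _ _
    _ ≤ _ := by rw [mul_assoc]; exact mul_le_mul_of_nonneg_left h1 hB

theorem sum_norm_partialSum_mul_exp_sub_le {B δ : ℝ} (hδ : 0 ≤ δ) {w : ℂ} (hw : δ < w.re)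
    (h : ∀ n, ‖lam.partialSum a 0 (n + 1)‖ ≤ B * Real.exp (δ * lam.seq n)) (N : ℕ) :
    ∑ n ∈ Finset.range N, ‖lam.partialSum a 0 (n + 1) *
      (Complex.exp (-(lam.seq n : ℂ) * w) - Complex.exp (-(lam.seq (n + 1) : ℂ) * w))‖
      ≤ B * (‖w‖ / (w.re - δ)) := by
  have hB : 0 ≤ B := by
    have := (norm_nonneg _).trans (h 0)
    exact nonneg_of_mul_nonneg_left this (Real.exp_pos _)
  have hr : 0 < w.re - δ := sub_pos.2 hw
  refine (Finset.sum_le_sum fun n _ => norm_partialSum_mul_exp_sub_le hδ hw h n).trans ?_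
  rw [← Finset.mul_sum, Finset.sum_range_sub']
  refine mul_le_of_le_one_right (by positivity) ?_
  have h1 : Real.exp (-((w.re - δ) * lam.seq 0)) ≤ 1 :=
    Real.exp_le_one_iff.2 (by have := mul_nonneg hr.le (lam.nonneg 0); linarith)
  have h2 := Real.exp_pos (-((w.re - δ) * lam.seq N))
  linarith

theorem norm_partialSum_zero_mul_exp_le {B δ : ℝ} {w : ℂ}
    (h : ∀ n, ‖lam.partialSum a 0 (n + 1)‖ ≤ B * Real.exp (δ * lam.seq n)) (N : ℕ) :
    ‖lam.partialSum a 0 (N + 1) * Complex.exp (-(lam.seq N : ℂ) * w)‖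
      ≤ B * Real.exp (-((w.re - δ) * lam.seq N)) := by
  rw [norm_mul, Complex.norm_exp]
  refine (mul_le_mul_of_nonneg_right (h N) (Real.exp_pos _).le).trans (le_of_eq ?_)
  rw [mul_assoc, ← Real.exp_add]; congr 2; simp; ring

/-- A Dirichlet series whose coefficient sums grow at most like `exp (δ λₙ)` has partial sums of
at most linear growth on vertical lines in `[Re > δ]`. -/
theorem norm_partialSum_le_of_sum_coeff_le {B δ : ℝ} (hδ : 0 ≤ δ) {w : ℂ} (hw : δ < w.re)
    (h : ∀ n, ‖lam.partialSum a 0 (n + 1)‖ ≤ B * Real.exp (δ * lam.seq n)) (N : ℕ) :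
    ‖lam.partialSum a w N‖ ≤ B * (1 + ‖w‖ / (w.re - δ)) := by
  have hB : 0 ≤ B := by
    have := (norm_nonneg _).trans (h 0)
    exact nonneg_of_mul_nonneg_left this (Real.exp_pos _)
  have hr : 0 < w.re - δ := sub_pos.2 hw
  cases N with
  | zero => simp only [partialSum, Finset.range_zero, Finset.sum_empty, norm_zero]; positivity
  | succ N =>
    rw [partialSum_by_parts, mul_add, mul_one]
    refine (norm_add_le _ _).trans (add_le_add ?_
      ((norm_sum_le _ _).trans (sum_norm_partialSum_mul_exp_sub_le hδ hw h N)))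
    refine (norm_partialSum_zero_mul_exp_le h N).trans (mul_le_of_le_one_right hB ?_)
    exact Real.exp_le_one_iff.2 (by have := mul_nonneg hr.le (lam.nonneg N); linarith)

/-- A Dirichlet series whose coefficient sums grow at most like `exp (δ λₙ)` converges on
`[Re > δ]`. -/
theorem convergesAt_of_sum_coeff_le {B δ : ℝ} (hδ : 0 ≤ δ) {w : ℂ} (hw : δ < w.re)
    (h : ∀ n, ‖lam.partialSum a 0 (n + 1)‖ ≤ B * Real.exp (δ * lam.seq n)) :
    lam.ConvergesAt a w := by
  have hr : 0 < w.re - δ := sub_pos.2 hw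
  have hs : Summable fun n => lam.partialSum a 0 (n + 1) *
      (Complex.exp (-(lam.seq n : ℂ) * w) - Complex.exp (-(lam.seq (n + 1) : ℂ) * w)) :=
    (summable_of_sum_range_le (fun _ => norm_nonneg _)
      (sum_norm_partialSum_mul_exp_sub_le hδ hw h)).of_norm
  have h0 : Tendsto (fun N => lam.partialSum a 0 (N + 1) * Complex.exp (-(lam.seq N : ℂ) * w))
      atTop (𝓝 0) := by
    refine squeeze_zero_norm (norm_partialSum_zero_mul_exp_le h) ?_
    rw [← mul_zero B]
    exact (Real.tendsto_exp_neg_atTop_nhds_zero.comp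
      (lam.tendsto_atTop.const_mul_atTop hr)).const_mul B
  refine ⟨_, (tendsto_add_atTop_iff_nat 1).1 ((h0.add hs.hasSum.tendsto_sum_nat).congr fun N => ?_)⟩
  rw [lam.partialSum_by_parts a w]

/-- If a Dirichlet series converges at a point `s₀`, then its partial sums grow at most
linearly along every vertical line to the right of `s₀`. -/
theorem ConvergesAt.exists_norm_partialSum_le {s₀ s : ℂ} (h : lam.ConvergesAt a s₀)
    (hs : s₀.re < s.re) :
    ∃ B : ℝ, ∀ (t : ℝ) (N : ℕ), ‖lam.partialSum a (s + t * Complex.I) N‖ ≤ B * (1 + |t|) := by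
  obtain ⟨z, hz⟩ := h
  obtain ⟨B, hB⟩ := hz.norm.bddAbove_range
  have hB' : ∀ n, ‖lam.partialSum a s₀ n‖ ≤ B := fun n => hB ⟨n, rfl⟩
  have hB0 : 0 ≤ B := (norm_nonneg _).trans (hB' 0)
  have hr : 0 < s.re - s₀.re := sub_pos.2 hs
  refine ⟨B * (1 + (‖s - s₀‖ + 1) / (s.re - s₀.re)), fun t N => ?_⟩
  have e : s + t * Complex.I = s₀ + (s - s₀ + t * Complex.I) := by ring
  have hre : (s - s₀ + t * Complex.I).re = s.re - s₀.re := by simp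
  -- With `s₀` moved to the origin, the bounded partial sums at `s₀` become coefficient sums of the
  -- twisted series, and the estimate with `δ = 0` applies.
  rw [e, partialSum_shift]
  have h1 := norm_partialSum_le_of_sum_coeff_le (lam := lam)
    (a := fun n => a n * Complex.exp (-(lam.seq n : ℂ) * s₀)) (B := B) le_rfl
    (w := s - s₀ + t * Complex.I) (by rw [hre]; exact hr)
    (fun n => by rw [← partialSum_shift]; simpa using hB' (n + 1)) N
  refine h1.trans ?_
  rw [hre, sub_zero, mul_assoc]
  refine mul_le_mul_of_nonneg_left ?_ hB0
  have h2 : ‖s - s₀ + t * Complex.I‖ ≤ ‖s - s₀‖ + |t| :=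
    (norm_add_le _ _).trans (by simp)
  have h3 : ‖s - s₀ + t * Complex.I‖ ≤ (‖s - s₀‖ + 1) * (1 + |t|) :=
    h2.trans (by nlinarith [norm_nonneg (s - s₀), abs_nonneg t])
  calc 1 + ‖s - s₀ + t * Complex.I‖ / (s.re - s₀.re)
      ≤ (1 + |t|) + (‖s - s₀‖ + 1) * (1 + |t|) / (s.re - s₀.re) := by
        gcongr; linarith [abs_nonneg t]
    _ = _ := by ring

end Frequency

/-! ### Averaging along vertical lines -/

/-- The Fourier transform `x ↦ ∫ K(t) exp(-i x t) dt` of a kernel `K` on the real line. -/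
noncomputable def kernelHat (K : ℝ → ℂ) (x : ℝ) : ℂ :=
  ∫ t : ℝ, K t * Complex.exp (-(x : ℂ) * (t * Complex.I))

theorem norm_exp_neg_mul_ofReal_mul_I (x t : ℝ) :
    ‖Complex.exp (-(x : ℂ) * (t * Complex.I))‖ = 1 := by
  rw [Complex.norm_exp]; simp

theorem integrable_kernel_mul_exp {K : ℝ → ℂ} (hK : MeasureTheory.Integrable K) (x : ℝ) :
    MeasureTheory.Integrable fun t : ℝ => K t * Complex.exp (-(x : ℂ) * (t * Complex.I)) := by
  refine hK.mul_bdd (c := 1) (Continuous.aestronglyMeasurable (by fun_prop)) ?_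
  exact Eventually.of_forall fun t => (norm_exp_neg_mul_ofReal_mul_I x t).le

theorem isOpen_re_gt (σ : ℝ) : IsOpen {s : ℂ | σ < s.re} :=
  isOpen_lt continuous_const Complex.continuous_re

theorem continuous_vertical {f : ℂ → ℂ} {σ : ℝ} (hf : DifferentiableOn ℂ f {s : ℂ | σ < s.re})
    {s : ℂ} (hs : σ < s.re) : Continuous fun t : ℝ => f (s + t * Complex.I) :=
  hf.continuousOn.comp_continuous (by fun_prop) fun t => by simpa using hs

theorem integrable_vertical_mul {f : ℂ → ℂ} {M : ℝ}
    (hf : DifferentiableOn ℂ f {s : ℂ | 0 < s.re}) (hM : ∀ s : ℂ, 0 < s.re → ‖f s‖ ≤ M)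
    {K : ℝ → ℂ} (hK : MeasureTheory.Integrable K) {s : ℂ} (hs : 0 < s.re) :
    MeasureTheory.Integrable fun t : ℝ => f (s + t * Complex.I) * K t :=
  hK.bdd_mul (c := M) (continuous_vertical hf hs).aestronglyMeasurable
    (Eventually.of_forall fun t => hM _ (by simpa using hs))

theorem norm_integral_vertical_mul_le {f : ℂ → ℂ} {M : ℝ}
    (hM : ∀ s : ℂ, 0 < s.re → ‖f s‖ ≤ M) {K : ℝ → ℂ} (hK : MeasureTheory.Integrable K)
    {s : ℂ} (hs : 0 < s.re) :
    ‖∫ t : ℝ, f (s + t * Complex.I) * K t‖ ≤ M * ∫ t, ‖K t‖ := by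
  rw [← MeasureTheory.integral_const_mul]
  refine MeasureTheory.norm_integral_le_of_norm_le (hK.norm.const_mul M)
    (Eventually.of_forall fun t => ?_)
  rw [norm_mul]
  exact mul_le_mul_of_nonneg_right (hM _ (by simpa using hs)) (norm_nonneg _)

/-- Differentiation under the integral. For `s` with real part above `s₀.re / 2`, discs of radius
`s₀.re / 4` stay in the right half-plane, so Cauchy's estimate bounds `deriv f` uniformly along the
whole vertical line. -/
theorem differentiableOn_integral_vertical_mul {f : ℂ → ℂ} {M : ℝ}
    (hf : DifferentiableOn ℂ f {s : ℂ | 0 < s.re}) (hM : ∀ s : ℂ, 0 < s.re → ‖f s‖ ≤ M)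
    {K : ℝ → ℂ} (hK : MeasureTheory.Integrable K) :
    DifferentiableOn ℂ (fun s : ℂ => ∫ t : ℝ, f (s + t * Complex.I) * K t)
      {s : ℂ | 0 < s.re} := by
  intro s₀ hs₀
  have hs₀' : 0 < s₀.re := hs₀
  have hdf : DifferentiableOn ℂ (deriv f) {s : ℂ | 0 < s.re} := hf.deriv (isOpen_re_gt 0)
  have hnhds : {s : ℂ | s₀.re / 2 < s.re} ∈ 𝓝 s₀ :=
    (isOpen_re_gt _).mem_nhds (show s₀.re / 2 < s₀.re by linarith)
  have hpos : ∀ {s : ℂ}, s ∈ {s : ℂ | s₀.re / 2 < s.re} → ∀ t : ℝ,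
      s₀.re / 2 < (s + t * Complex.I).re := by
    intro s hs t
    simpa using hs
  have key := hasDerivAt_integral_of_dominated_loc_of_deriv_le (μ := MeasureTheory.volume)
    (F := fun (s : ℂ) (t : ℝ) => f (s + t * Complex.I) * K t)
    (F' := fun (s : ℂ) (t : ℝ) => deriv f (s + t * Complex.I) * K t)
    (bound := fun t => M / (s₀.re / 4) * ‖K t‖) hnhds
    (by
      filter_upwards [hnhds] with s hs
      exact (integrable_vertical_mul hf hM hK
        (show 0 < s.re by have : s₀.re / 2 < s.re := hs; linarith)).aestronglyMeasurable)
    (integrable_vertical_mul hf hM hK hs₀')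
    ((continuous_vertical hdf hs₀').aestronglyMeasurable.mul hK.aestronglyMeasurable)
    (Eventually.of_forall fun t s hs => by
      rw [norm_mul]
      refine mul_le_mul_of_nonneg_right ?_ (norm_nonneg _)
      have hball : ∀ z ∈ Metric.closedBall (s + t * Complex.I) (s₀.re / 4), 0 < z.re := by
        intro z hz
        have h1 := hpos hs t
        have h2 : |(z - (s + t * Complex.I)).re| ≤ s₀.re / 4 :=
          (Complex.abs_re_le_norm _).trans (by simpa [dist_eq_norm] using hz)
        rw [Complex.sub_re] at h2
        linarith [(abs_le.1 h2).1]
      refine Complex.norm_deriv_le_of_forall_mem_sphere_norm_le (by linarith) ?_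
        (fun z hz => hM z (hball z (Metric.sphere_subset_closedBall hz)))
      exact (hf.mono hball).diffContOnCl_ball subset_rfl)
    (hK.norm.const_mul _)
    (Eventually.of_forall fun t s hs => by
      have h1 : 0 < (s + t * Complex.I).re := by have := hpos hs t; linarith
      have h2 := (hf.differentiableAt ((isOpen_re_gt 0).mem_nhds h1)).hasDerivAt
      exact (h2.comp_add_const s (t * Complex.I)).mul_const (K t))
  exact key.2.differentiableAt.differentiableWithinAt

namespace Frequency

variable {lam : Frequency} {a : ℕ → ℂ}

theorem integral_partialSum_mul {K : ℝ → ℂ} (hK : MeasureTheory.Integrable K) (s : ℂ) (N : ℕ) :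
    ∫ t : ℝ, lam.partialSum a (s + t * Complex.I) N * K t
      = ∑ n ∈ Finset.range N,
        a n * kernelHat K (lam.seq n) * Complex.exp (-(lam.seq n : ℂ) * s) := by
  have e : ∀ t : ℝ, lam.partialSum a (s + t * Complex.I) N * K t
      = ∑ n ∈ Finset.range N, (a n * Complex.exp (-(lam.seq n : ℂ) * s)) *
        (K t * Complex.exp (-(lam.seq n : ℂ) * (t * Complex.I))) := by
    intro t
    rw [partialSum, Finset.sum_mul]
    refine Finset.sum_congr rfl fun n _ => ?_
    rw [mul_add, Complex.exp_add]; ring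
  simp_rw [e]
  rw [MeasureTheory.integral_finsetSum _
    fun n _ => (integrable_kernel_mul_exp hK (lam.seq n)).const_mul _]
  refine Finset.sum_congr rfl fun n _ => ?_
  rw [MeasureTheory.integral_const_mul, kernelHat]; ring

/-- The partial sums are dominated on some half-plane by an integrable function against the
kernel `K`. -/
def Dominated (lam : Frequency) (a : ℕ → ℂ) (K : ℝ → ℂ) : Prop :=
  ∃ σ : ℝ, ∀ s : ℂ, σ < s.re → ∃ g : ℝ → ℝ, MeasureTheory.Integrable g ∧
    ∀ (N : ℕ) (t : ℝ), ‖lam.partialSum a (s + t * Complex.I) N‖ * ‖K t‖ ≤ g t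

/-- Averaging the extension against a kernel whose transform vanishes at `λₙ` for `n ≥ N` gives a
Dirichlet polynomial. -/
theorem IsBoundedExtension.integral_mul_kernel {f : ℂ → ℂ} (hf : lam.IsBoundedExtension a 0 f)
    {K : ℝ → ℂ} (hK : MeasureTheory.Integrable K) (hdom : lam.Dominated a K) {N : ℕ}
    (hN : ∀ n, N ≤ n → kernelHat K (lam.seq n) = 0) {s : ℂ} (hs : 0 < s.re) :
    ∫ t : ℝ, f (s + t * Complex.I) * K t
      = ∑ n ∈ Finset.range N,
        a n * kernelHat K (lam.seq n) * Complex.exp (-(lam.seq n : ℂ) * s) := by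
  obtain ⟨σ₁, hσ₁⟩ := hdom
  obtain ⟨σ₀, hσ₀, hlim⟩ := hf.agrees
  obtain ⟨M, hM⟩ := hf.bdd
  have hright : ∀ s : ℂ, max σ₀ σ₁ < s.re → ∫ t : ℝ, f (s + t * Complex.I) * K t
      = ∑ n ∈ Finset.range N,
        a n * kernelHat K (lam.seq n) * Complex.exp (-(lam.seq n : ℂ) * s) := by
    intro s hs
    obtain ⟨g, hg, hle⟩ := hσ₁ s ((le_max_right _ _).trans_lt hs)
    have h1 := MeasureTheory.tendsto_integral_of_dominated_convergence
      (F := fun (n : ℕ) (t : ℝ) => lam.partialSum a (s + t * Complex.I) n * K t)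
      (f := fun t : ℝ => f (s + t * Complex.I) * K t) g
      (fun n => by
        refine MeasureTheory.AEStronglyMeasurable.mul (Continuous.aestronglyMeasurable ?_)
          hK.aestronglyMeasurable
        simp only [partialSum]
        fun_prop)
      hg (fun n => Eventually.of_forall fun t => by rw [norm_mul]; exact hle n t)
      (Eventually.of_forall fun t => (hlim _ (by
        simpa using (le_max_left _ _).trans_lt hs)).mul_const _)
    -- The integrals are constant from index `N` on, since later terms are killed by the transform.
    refine tendsto_nhds_unique h1 (tendsto_const_nhds.congr' ?_)
    filter_upwards [eventually_ge_atTop N] with n hn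
    rw [integral_partialSum_mul hK]
    refine Finset.sum_subset (Finset.range_mono hn) fun m _ hm => ?_
    rw [hN m (by simpa using hm), mul_zero, zero_mul]
  have hz : (0 : ℝ) < (((max σ₀ σ₁ + 1 : ℝ) : ℂ)).re := by
    rw [Complex.ofReal_re]; linarith [le_max_left σ₀ σ₁]
  -- Both sides are holomorphic on `[Re > 0]`, so their equality far to the right propagates.
  refine ((differentiableOn_integral_vertical_mul hf.holo hM hK).analyticOnNhd
    (isOpen_re_gt 0)).eqOn_of_preconnected_of_eventuallyEq
    (g := fun s => ∑ n ∈ Finset.range N,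
        a n * kernelHat K (lam.seq n) * Complex.exp (-(lam.seq n : ℂ) * s))
    (DifferentiableOn.analyticOnNhd (by fun_prop) (isOpen_re_gt 0))
    (convex_halfSpace_re_gt 0).isPreconnected hz ?_ hs
  filter_upwards [(isOpen_re_gt (max σ₀ σ₁)).mem_nhds
    (show max σ₀ σ₁ < (((max σ₀ σ₁ + 1 : ℝ) : ℂ)).re by rw [Complex.ofReal_re]; linarith)]
    with w hw
  exact hright w hw

/-- A Dirichlet polynomial is continuous up to the imaginary axis, so the bound survives the limit
to `Re s = 0`, where `f` itself need not be defined as a boundary value. -/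
theorem IsBoundedExtension.norm_sum_mul_kernelHat_le {f : ℂ → ℂ}
    (hf : lam.IsBoundedExtension a 0 f) {M : ℝ} (hM : ∀ s : ℂ, 0 < s.re → ‖f s‖ ≤ M)
    {K : ℝ → ℂ} (hK : MeasureTheory.Integrable K) (hdom : lam.Dominated a K) {N : ℕ}
    (hN : ∀ n, N ≤ n → kernelHat K (lam.seq n) = 0) {s : ℂ} (hs : 0 ≤ s.re) :
    ‖∑ n ∈ Finset.range N,
        a n * kernelHat K (lam.seq n) * Complex.exp (-(lam.seq n : ℂ) * s)‖
      ≤ M * ∫ t, ‖K t‖ := by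
  have hlim : Tendsto (fun x : ℝ => ‖∑ n ∈ Finset.range N,
      a n * kernelHat K (lam.seq n) * Complex.exp (-(lam.seq n : ℂ) * (s + x))‖) (𝓝[>] 0)
      (𝓝 ‖∑ n ∈ Finset.range N,
        a n * kernelHat K (lam.seq n) * Complex.exp (-(lam.seq n : ℂ) * s)‖) := by
    have hc : Continuous fun x : ℝ => ‖∑ n ∈ Finset.range N,
        a n * kernelHat K (lam.seq n) * Complex.exp (-(lam.seq n : ℂ) * (s + x))‖ := by fun_prop
    have := hc.tendsto 0
    simp only [Complex.ofReal_zero, add_zero] at this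
    exact this.mono_left nhdsWithin_le_nhds
  refine le_of_tendsto hlim ?_
  filter_upwards [self_mem_nhdsWithin] with x hx
  have hx' : 0 < (s + (x : ℂ)).re := by
    have : 0 < x := hx
    simp; linarith
  rw [← hf.integral_mul_kernel hK hdom hN hx']
  exact norm_integral_vertical_mul_le hM hK hx'

/-- Convergence at one point gives linear growth of the partial sums on lines further right,
uniformly in `N`; the weight absorbs it. -/
theorem IsBoundedExtension.dominated_of_integrable_weight {f : ℂ → ℂ} {σ : ℝ}
    (hf : lam.IsBoundedExtension a σ f) {K : ℝ → ℂ}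
    (hK : MeasureTheory.Integrable fun t : ℝ => (1 + |t|) * ‖K t‖) : lam.Dominated a K := by
  obtain ⟨σ₀, -, hlim⟩ := hf.agrees
  refine ⟨σ₀ + 1, fun s hs => ?_⟩
  have hc : lam.ConvergesAt a ((σ₀ + 1 : ℝ) : ℂ) :=
    ⟨_, hlim _ (by rw [Complex.ofReal_re]; linarith)⟩
  obtain ⟨B, hB⟩ := hc.exists_norm_partialSum_le (s := s) (by rwa [Complex.ofReal_re])
  refine ⟨_, hK.const_mul B, fun N t => ?_⟩
  rw [← mul_assoc]
  exact mul_le_mul_of_nonneg_right (hB t N) (norm_nonneg _)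

theorem norm_term_le {σ : ℝ} {s : ℂ} (hs : σ ≤ s.re) (n : ℕ) :
    ‖a n * Complex.exp (-(lam.seq n : ℂ) * s)‖ ≤ ‖a n‖ * Real.exp (-(σ * lam.seq n)) := by
  rw [norm_mul, Complex.norm_exp]
  refine mul_le_mul_of_nonneg_left (Real.exp_le_exp.2 ?_) (norm_nonneg _)
  have := mul_le_mul_of_nonneg_right hs (lam.nonneg n)
  simp; linarith

/-- Absolute convergence bounds the partial sums uniformly, so no decay of the kernel beyond
integrability is needed. -/
theorem dominated_of_summable {σ : ℝ}
    (h : Summable fun n => ‖a n‖ * Real.exp (-(σ * lam.seq n))) {K : ℝ → ℂ}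
    (hK : MeasureTheory.Integrable K) : lam.Dominated a K := by
  refine ⟨σ, fun s hs => ⟨_, hK.norm.const_mul (∑' n, ‖a n‖ * Real.exp (-(σ * lam.seq n))),
    fun N t => mul_le_mul_of_nonneg_right ?_ (norm_nonneg _)⟩⟩
  refine (norm_sum_le _ _).trans ((Finset.sum_le_sum fun n _ =>
    norm_term_le (σ := σ) (by simpa using hs.le) n).trans ?_)
  exact h.sum_le_tsum _ fun n _ => by positivity

end Frequency

/-! ### Kernels with compactly supported transform -/

open FourierTransform in
-- Fourier inversion; the rescaling by `2π` translates between Mathlib's normalisation and the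
-- exponent `-i x t` of `kernelHat`.
theorem kernelHat_fourier_comp_div {g : ℝ → ℂ} (hg : Continuous g)
    (hgi : MeasureTheory.Integrable g) (hFg : MeasureTheory.Integrable (𝓕 g)) (x : ℝ) :
    kernelHat (fun t => 𝓕 g ((2 * Real.pi)⁻¹ * t)) x = 2 * Real.pi * g (-x) := by
  have hpi : (0 : ℝ) < 2 * Real.pi := by positivity
  have h1 := congrFun (hg.fourierInv_fourier_eq hgi hFg) (-x)
  rw [Real.fourierInv_eq'] at h1
  have h2 := MeasureTheory.Measure.integral_comp_mul_left
    (fun v : ℝ => Complex.exp (((2 * Real.pi * inner ℝ v (-x) : ℝ) : ℂ) * Complex.I) • 𝓕 g v)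
    (2 * Real.pi)⁻¹
  rw [h1, inv_inv, abs_of_pos hpi] at h2
  have e : ((2 * Real.pi : ℝ) • g (-x) : ℂ) = 2 * Real.pi * g (-x) := by
    rw [Complex.real_smul]; push_cast; ring
  rw [← e, ← h2, kernelHat]
  congr 1; funext t
  rw [smul_eq_mul, mul_comm]
  congr 2
  simp only [RCLike.inner_apply, conj_trivial]
  push_cast
  have : (Real.pi : ℂ) ≠ 0 := by exact_mod_cast Real.pi_ne_zero
  field_simp

theorem kernelHat_comp_mul (K : ℝ → ℂ) {c : ℝ} (hc : 0 < c) (x : ℝ) :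
    kernelHat (fun t => K (c * t)) x = (c : ℂ)⁻¹ * kernelHat K (x / c) := by
  have h := MeasureTheory.Measure.integral_comp_mul_left
    (fun t : ℝ => K t * Complex.exp (-((x / c : ℝ) : ℂ) * (t * Complex.I))) c
  rw [abs_of_pos (inv_pos.2 hc), Complex.real_smul] at h
  rw [kernelHat, kernelHat, ← Complex.ofReal_inv, ← h]
  congr 1; funext t
  congr 2
  have : (c : ℂ) ≠ 0 := by exact_mod_cast hc.ne'
  push_cast
  field_simp

/-! ### The tent function and its Fourier transform -/

/-- The tent function `x ↦ max 0 (1 - |x|)`. -/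
noncomputable def tent (x : ℝ) : ℂ := (max 0 (1 - |x|) : ℝ)

theorem continuous_tent : Continuous tent := by unfold tent; fun_prop

theorem tent_neg (x : ℝ) : tent (-x) = tent x := by simp [tent]

theorem tent_of_one_le_abs {x : ℝ} (h : 1 ≤ |x|) : tent x = 0 := by
  simp [tent, max_eq_left (sub_nonpos.2 h)]

theorem hasCompactSupport_tent : HasCompactSupport tent := by
  refine HasCompactSupport.intro (isCompact_Icc (a := (-1 : ℝ)) (b := 1)) fun x hx => ?_
  refine tent_of_one_le_abs (le_of_lt ?_)
  by_contra! h
  exact hx (abs_le.1 h)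

theorem integrable_tent : MeasureTheory.Integrable tent :=
  continuous_tent.integrable_of_hasCompactSupport hasCompactSupport_tent

theorem integral_exp_mul_tent {c : ℂ} (hc : c ≠ 0) :
    ∫ x : ℝ, Complex.exp (c * x) * tent x = (Complex.exp c + Complex.exp (-c) - 2) / c ^ 2 := by
  have h0 : ∀ x : ℝ, x ∉ Set.Ioc (-1 : ℝ) 1 → Complex.exp (c * x) * tent x = 0 := by
    intro x hx
    rw [tent_of_one_le_abs, mul_zero]
    by_contra! h
    exact hx ⟨(abs_lt.1 h).1, (abs_lt.1 h).2.le⟩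
  have hcont : Continuous fun x : ℝ => Complex.exp (c * x) * tent x :=
    Continuous.mul (by fun_prop) continuous_tent
  rw [← MeasureTheory.setIntegral_eq_integral_of_forall_compl_eq_zero h0,
    ← intervalIntegral.integral_of_le (by norm_num),
    ← intervalIntegral.integral_add_adjacent_intervals (b := 0)
      (hcont.intervalIntegrable _ _) (hcont.intervalIntegrable _ _)]
  have hexp : ∀ x : ℝ, HasDerivAt (fun x : ℝ => Complex.exp (c * x))
      (c * Complex.exp (c * x)) x := by
    intro x
    have := ((Complex.ofRealCLM.hasDerivAt (x := x)).const_mul c).cexp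
    refine this.congr_deriv ?_
    simp [mul_comm]
  have hid : ∀ x : ℝ, HasDerivAt (fun x : ℝ => (x : ℂ)) 1 x := fun x =>
    (Complex.ofRealCLM.hasDerivAt (x := x)).congr_deriv (by simp)
  have hl : ∫ x : ℝ in (-1)..0, Complex.exp (c * x) * tent x
      = ((1 + ((0 : ℝ) : ℂ)) / c - 1 / c ^ 2) * Complex.exp (c * (0 : ℝ))
        - ((1 + ((-1 : ℝ) : ℂ)) / c - 1 / c ^ 2) * Complex.exp (c * (-1 : ℝ)) := by
    refine intervalIntegral.integral_eq_sub_of_hasDerivAt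
      (f := fun x : ℝ => ((1 + (x : ℂ)) / c - 1 / c ^ 2) * Complex.exp (c * x)) ?_
      (hcont.intervalIntegrable _ _)
    intro x hx
    rw [Set.uIcc_of_le (by norm_num)] at hx
    refine (((((hid x).const_add 1).div_const c).sub_const (1 / c ^ 2)).mul (hexp x)).congr_deriv ?_
    rw [tent, abs_of_nonpos hx.2, max_eq_right (by linarith [hx.1])]
    push_cast
    field_simp
    ring
  have hr : ∫ x : ℝ in (0)..1, Complex.exp (c * x) * tent x
      = ((1 - ((1 : ℝ) : ℂ)) / c + 1 / c ^ 2) * Complex.exp (c * (1 : ℝ))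
        - ((1 - ((0 : ℝ) : ℂ)) / c + 1 / c ^ 2) * Complex.exp (c * (0 : ℝ)) := by
    refine intervalIntegral.integral_eq_sub_of_hasDerivAt
      (f := fun x : ℝ => ((1 - (x : ℂ)) / c + 1 / c ^ 2) * Complex.exp (c * x)) ?_
      (hcont.intervalIntegrable _ _)
    intro x hx
    rw [Set.uIcc_of_le (by norm_num)] at hx
    refine (((((hid x).const_sub 1).div_const c).add_const (1 / c ^ 2)).mul (hexp x)).congr_deriv ?_
    rw [tent, abs_of_nonneg hx.1, max_eq_right (by linarith [hx.2])]
    push_cast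
    field_simp
    ring
  rw [hl, hr]
  push_cast
  simp only [mul_zero, Complex.exp_zero, mul_neg, mul_one]
  field_simp
  ring

theorem integral_tent : ∫ x : ℝ, tent x = 1 := by
  have h0 : ∀ x : ℝ, x ∉ Set.Ioc (-1 : ℝ) 1 → tent x = 0 := by
    intro x hx
    refine tent_of_one_le_abs ?_
    by_contra! h
    exact hx ⟨(abs_lt.1 h).1, (abs_lt.1 h).2.le⟩
  rw [← MeasureTheory.setIntegral_eq_integral_of_forall_compl_eq_zero h0,
    ← intervalIntegral.integral_of_le (by norm_num),
    ← intervalIntegral.integral_add_adjacent_intervals (b := 0)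
      (continuous_tent.intervalIntegrable _ _) (continuous_tent.intervalIntegrable _ _)]
  have hid : ∀ x : ℝ, HasDerivAt (fun x : ℝ => (x : ℂ)) 1 x := fun x =>
    (Complex.ofRealCLM.hasDerivAt (x := x)).congr_deriv (by simp)
  have hl : ∫ x : ℝ in (-1)..0, tent x
      = (((0 : ℝ) : ℂ) + ((0 : ℝ) : ℂ) ^ 2 / 2) - (((-1 : ℝ) : ℂ) + ((-1 : ℝ) : ℂ) ^ 2 / 2) := by
    refine intervalIntegral.integral_eq_sub_of_hasDerivAt
      (f := fun x : ℝ => (x : ℂ) + (x : ℂ) ^ 2 / 2) ?_ (continuous_tent.intervalIntegrable _ _)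
    intro x hx
    rw [Set.uIcc_of_le (by norm_num)] at hx
    refine ((hid x).add (((hid x).pow 2).div_const 2)).congr_deriv ?_
    rw [tent, abs_of_nonpos hx.2, max_eq_right (by linarith [hx.1])]
    push_cast
    ring
  have hr : ∫ x : ℝ in (0)..1, tent x
      = (((1 : ℝ) : ℂ) - ((1 : ℝ) : ℂ) ^ 2 / 2) - (((0 : ℝ) : ℂ) - ((0 : ℝ) : ℂ) ^ 2 / 2) := by
    refine intervalIntegral.integral_eq_sub_of_hasDerivAt
      (f := fun x : ℝ => (x : ℂ) - (x : ℂ) ^ 2 / 2) ?_ (continuous_tent.intervalIntegrable _ _)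
    intro x hx
    rw [Set.uIcc_of_le (by norm_num)] at hx
    refine ((hid x).sub (((hid x).pow 2).div_const 2)).congr_deriv ?_
    rw [tent, abs_of_nonneg hx.1, max_eq_right (by linarith [hx.2])]
    push_cast
    ring
  rw [hl, hr]
  push_cast
  ring

open FourierTransform in
theorem fourier_tent (w : ℝ) : 𝓕 tent w = ((Real.sinc (Real.pi * w) ^ 2 : ℝ) : ℂ) := by
  rw [Real.fourier_eq']
  simp only [RCLike.inner_apply, conj_trivial, smul_eq_mul]
  rcases eq_or_ne w 0 with rfl | hw
  · simpa using integral_tent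
  have hk : Real.pi * w ≠ 0 := mul_ne_zero Real.pi_ne_zero hw
  have hk' : ((Real.pi * w : ℝ) : ℂ) ≠ 0 := by exact_mod_cast hk
  have hc : -(2 * ((Real.pi * w : ℝ) : ℂ)) * Complex.I ≠ 0 :=
    mul_ne_zero (neg_ne_zero.2 (mul_ne_zero two_ne_zero hk')) Complex.I_ne_zero
  have h := integral_exp_mul_tent hc
  have e : ∀ v : ℝ, Complex.exp (((-2 * Real.pi * (w * v) : ℝ) : ℂ) * Complex.I) * tent v
      = Complex.exp (-(2 * ((Real.pi * w : ℝ) : ℂ)) * Complex.I * v) * tent v := by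
    intro v; congr 2; push_cast; ring
  simp_rw [e]
  rw [h, Real.sinc_of_ne_zero hk]
  have h2 : Complex.exp (-(2 * ((Real.pi * w : ℝ) : ℂ)) * Complex.I)
      + Complex.exp (-(-(2 * ((Real.pi * w : ℝ) : ℂ)) * Complex.I))
      = 2 * Complex.cos (2 * ((Real.pi * w : ℝ) : ℂ)) := by
    rw [Complex.two_cos, neg_mul, neg_neg, add_comm]
  rw [h2, Complex.cos_two_mul, mul_pow, Complex.I_sq, Complex.cos_sq']
  push_cast
  push_cast at hk'
  field_simp
  ring

theorem sinc_sq_le (x : ℝ) : Real.sinc x ^ 2 ≤ 2 * (1 + x ^ 2)⁻¹ := by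
  have h1 : Real.sinc x ^ 2 ≤ 1 := by
    rw [sq_le_one_iff_abs_le_one]; exact Real.abs_sinc_le_one x
  have h2 : Real.sinc x ^ 2 * x ^ 2 ≤ 1 := by
    rcases eq_or_ne x 0 with rfl | hx
    · simp
    · rw [Real.sinc_of_ne_zero hx, div_pow, div_mul_cancel₀ _ (pow_ne_zero 2 hx)]
      exact Real.sin_sq_le_one x
  rw [← div_eq_mul_inv, le_div_iff₀ (by positivity)]
  linarith

theorem integrable_sinc_sq : MeasureTheory.Integrable fun x : ℝ => Real.sinc x ^ 2 := by
  refine (integrable_inv_one_add_sq.const_mul 2).mono'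
    (Real.continuous_sinc.pow 2).aestronglyMeasurable (Eventually.of_forall fun x => ?_)
  rw [Real.norm_of_nonneg (sq_nonneg _)]
  exact sinc_sq_le x

/-- The fourth power decays like `x⁻⁴` and tolerates a linear weight, which the square would not. -/
theorem integrable_weight_sinc_pow_four :
    MeasureTheory.Integrable fun x : ℝ => (1 + |x|) * Real.sinc x ^ 4 := by
  refine (integrable_inv_one_add_sq.const_mul 8).mono'
    (Continuous.aestronglyMeasurable ?_) (Eventually.of_forall fun x => ?_)
  · have := Real.continuous_sinc
    fun_prop
  · rw [Real.norm_of_nonneg (by positivity)]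
    have h := sinc_sq_le x
    have h1 : Real.sinc x ^ 4 ≤ (2 * (1 + x ^ 2)⁻¹) ^ 2 := by
      have e : Real.sinc x ^ 4 = (Real.sinc x ^ 2) ^ 2 := by ring
      rw [e]; exact pow_le_pow_left₀ (sq_nonneg _) h 2
    have h2 : 1 + |x| ≤ 2 * (1 + x ^ 2) := by
      nlinarith [sq_nonneg (|x| - 1), sq_abs x, abs_nonneg x]
    calc (1 + |x|) * Real.sinc x ^ 4
        ≤ (2 * (1 + x ^ 2)) * (2 * (1 + x ^ 2)⁻¹) ^ 2 := by gcongr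
      _ = 8 * (1 + x ^ 2)⁻¹ := by field_simp; norm_num

theorem integrable_sinc_pow_four : MeasureTheory.Integrable fun x : ℝ => Real.sinc x ^ 4 := by
  refine integrable_weight_sinc_pow_four.mono'
    (Real.continuous_sinc.pow 4).aestronglyMeasurable (Eventually.of_forall fun x => ?_)
  rw [Real.norm_of_nonneg (by positivity)]
  exact le_mul_of_one_le_left (by positivity) (by linarith [abs_nonneg x])

/-! ### The Fejér and Jackson kernels -/

/-- The Fejér kernel (unnormalised). -/
noncomputable def fejer (t : ℝ) : ℂ := (Real.sinc (t / 2) ^ 2 : ℝ)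

/-- The Jackson kernel (unnormalised). -/
noncomputable def jackson (t : ℝ) : ℂ := (Real.sinc (t / 2) ^ 4 : ℝ)

theorem continuous_jackson : Continuous jackson := by
  have := Real.continuous_sinc
  unfold jackson
  fun_prop

theorem integrable_fejer : MeasureTheory.Integrable fejer :=
  (integrable_sinc_sq.comp_div two_ne_zero).ofReal

theorem integrable_weight_jackson :
    MeasureTheory.Integrable fun t : ℝ => (1 + |t|) * ‖jackson t‖ := by
  refine ((integrable_weight_sinc_pow_four.comp_div two_ne_zero).const_mul 2).mono'
    (Continuous.aestronglyMeasurable ?_) (Eventually.of_forall fun t => ?_)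
  · have := continuous_jackson
    fun_prop
  · rw [Real.norm_of_nonneg (by positivity), jackson, Complex.norm_of_nonneg (by positivity),
      ← mul_assoc]
    refine mul_le_mul_of_nonneg_right ?_ (by positivity)
    rw [abs_div, abs_two]
    linarith [abs_nonneg t]

theorem integrable_jackson : MeasureTheory.Integrable jackson :=
  (integrable_sinc_pow_four.comp_div two_ne_zero).ofReal

open FourierTransform in
theorem integrable_fourier_tent : MeasureTheory.Integrable (𝓕 tent) := by
  have e : 𝓕 tent = fun w => ((Real.sinc (Real.pi * w) ^ 2 : ℝ) : ℂ) := funext fourier_tent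
  rw [e]
  exact (integrable_sinc_sq.comp_mul_left' Real.pi_ne_zero).ofReal

theorem kernelHat_fejer (x : ℝ) : kernelHat fejer x = 2 * Real.pi * tent x := by
  rw [← tent_neg, ← kernelHat_fourier_comp_div continuous_tent integrable_tent
    integrable_fourier_tent]
  congr 1; funext t
  rw [fourier_tent, fejer]
  congr 3
  field_simp

open Convolution in
/-- The convolution of the tent function with itself. -/
noncomputable def tentConv : ℝ → ℂ := tent ⋆[ContinuousLinearMap.mul ℂ ℂ] tent

theorem continuous_tentConv : Continuous tentConv :=
  hasCompactSupport_tent.continuous_convolution_right _ integrable_tent.locallyIntegrable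
    continuous_tent

theorem tentConv_of_two_le_abs {x : ℝ} (h : 2 ≤ |x|) : tentConv x = 0 := by
  by_contra hne
  obtain ⟨u, hu, v, hv, rfl⟩ := MeasureTheory.support_convolution_subset
    (ContinuousLinearMap.mul ℂ ℂ) (f := tent) (g := tent) (Function.mem_support.2 hne)
  have hu' : |u| < 1 := by
    by_contra! h1
    exact hu (tent_of_one_le_abs h1)
  have hv' : |v| < 1 := by
    by_contra! h1
    exact hv (tent_of_one_le_abs h1)
  have : |u + v| ≤ |u| + |v| := abs_add_le u v
  simp only at h
  linarith

open FourierTransform in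
theorem fourier_tentConv (w : ℝ) :
    𝓕 tentConv w = ((Real.sinc (Real.pi * w) ^ 4 : ℝ) : ℂ) := by
  rw [tentConv, Real.fourier_mul_convolution_eq integrable_tent integrable_tent, fourier_tent]
  push_cast; ring

theorem kernelHat_jackson (x : ℝ) : kernelHat jackson x = 2 * Real.pi * tentConv (-x) := by
  have hi : MeasureTheory.Integrable tentConv :=
    integrable_tent.integrable_convolution _ integrable_tent
  have hF : MeasureTheory.Integrable (FourierTransform.fourier tentConv) := by
    rw [show FourierTransform.fourier tentConv
      = fun w => ((Real.sinc (Real.pi * w) ^ 4 : ℝ) : ℂ) from funext fourier_tentConv]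
    exact (integrable_sinc_pow_four.comp_mul_left' Real.pi_ne_zero).ofReal
  rw [← kernelHat_fourier_comp_div continuous_tentConv hi hF]
  congr 1; funext t
  rw [fourier_tentConv, jackson]
  congr 3
  field_simp

theorem kernelHat_jackson_of_two_le_abs {x : ℝ} (h : 2 ≤ |x|) : kernelHat jackson x = 0 := by
  rw [kernelHat_jackson, tentConv_of_two_le_abs (by rwa [abs_neg]), mul_zero]

theorem continuous_kernelHat_jackson : Continuous (kernelHat jackson) := by
  have e : kernelHat jackson = fun x => 2 * Real.pi * tentConv (-x) := funext kernelHat_jackson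
  have := continuous_tentConv
  rw [e]
  fun_prop

theorem kernelHat_zero_eq_integral_norm {K : ℝ → ℂ} (hK : ∀ t, K t = (‖K t‖ : ℂ)) :
    kernelHat K 0 = ((∫ t, ‖K t‖ : ℝ) : ℂ) := by
  rw [kernelHat, ← integral_complex_ofReal]
  congr 1; funext t
  simpa using hK t

theorem jackson_eq_norm (t : ℝ) : jackson t = (‖jackson t‖ : ℂ) := by
  rw [jackson, Complex.norm_of_nonneg (by positivity)]

theorem fejer_eq_norm (t : ℝ) : fejer t = (‖fejer t‖ : ℂ) := by
  rw [fejer, Complex.norm_of_nonneg (by positivity)]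

theorem integral_norm_jackson_pos : 0 < ∫ t, ‖jackson t‖ := by
  refine MeasureTheory.integral_pos_of_integrable_nonneg_nonzero (x := 0) continuous_jackson.norm
    integrable_jackson.norm (fun t => norm_nonneg _) ?_
  simp [jackson]

theorem kernelHat_mul_exp (K : ℝ → ℂ) (μ x : ℝ) :
    kernelHat (fun t => K t * Complex.exp (μ * (t * Complex.I))) x = kernelHat K (x - μ) := by
  rw [kernelHat, kernelHat]
  congr 1; funext t
  rw [mul_assoc, ← Complex.exp_add]
  congr 2; push_cast; ring

theorem integrable_weight_jackson_comp_mul {c : ℝ} (hc : 0 < c) :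
    MeasureTheory.Integrable fun t : ℝ => (1 + |t|) * ‖jackson (c * t)‖ := by
  have hJ := continuous_jackson
  refine ((integrable_weight_jackson.comp_mul_left' hc.ne').const_mul (1 + c⁻¹)).mono'
    (Continuous.aestronglyMeasurable (by fun_prop)) (Eventually.of_forall fun t => ?_)
  rw [Real.norm_of_nonneg (by positivity), ← mul_assoc]
  refine mul_le_mul_of_nonneg_right ?_ (norm_nonneg _)
  rw [abs_mul, abs_of_pos hc]
  have e : (1 + c⁻¹) * (1 + c * |t|) = 1 + |t| + c⁻¹ + c * |t| := by
    field_simp; ring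
  rw [e]
  have := mul_nonneg hc.le (abs_nonneg t)
  have := inv_pos.2 hc
  linarith

theorem integral_norm_jackson_comp_mul {c : ℝ} (hc : 0 < c) :
    ∫ t, ‖jackson (c * t)‖ = c⁻¹ * ∫ t, ‖jackson t‖ := by
  rw [MeasureTheory.Measure.integral_comp_mul_left (fun t => ‖jackson t‖),
    abs_of_pos (inv_pos.2 hc), smul_eq_mul]

/-! ### Coefficient bounds and completeness -/

namespace Frequency

variable {lam : Frequency} {a : ℕ → ℂ}

theorem exists_separation (lam : Frequency) (n : ℕ) :
    ∃ d > 0, ∀ m, m ≠ n → d ≤ |lam.seq m - lam.seq n| := by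
  have hright : 0 < lam.seq (n + 1) - lam.seq n := sub_pos.2 (lam.strictMono (Nat.lt_succ_self n))
  have hr : ∀ m, n < m → lam.seq (n + 1) - lam.seq n ≤ |lam.seq m - lam.seq n| := by
    intro m hm
    have := lam.strictMono.monotone (Nat.succ_le_of_lt hm)
    exact le_trans (by simpa using this) (le_abs_self _)
  cases n with
  | zero => exact ⟨_, hright, fun m hm => hr m (Nat.pos_of_ne_zero hm)⟩
  | succ k =>
    have hleft : 0 < lam.seq (k + 1) - lam.seq k := sub_pos.2 (lam.strictMono (Nat.lt_succ_self k))
    refine ⟨_, lt_min hright hleft, fun m hm => ?_⟩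
    rcases lt_or_gt_of_ne hm with h | h
    · have := lam.strictMono.monotone (Nat.le_of_lt_succ h)
      rw [abs_sub_comm]
      exact (min_le_right _ _).trans (le_trans (by linarith) (le_abs_self _))
    · exact (min_le_left _ _).trans (hr m h)

/-- The coefficients are bounded by the supremum of the extension. -/
theorem IsBoundedExtension.norm_coeff_le {f : ℂ → ℂ} (hf : lam.IsBoundedExtension a 0 f) {M : ℝ}
    (hM : ∀ s : ℂ, 0 < s.re → ‖f s‖ ≤ M) (n : ℕ) : ‖a n‖ ≤ M := by
  obtain ⟨d, hd, hsep⟩ := lam.exists_separation n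
  have hc : 0 < d / 2 := by positivity
  -- The transform of `jackson` lives in `[-2, 2]`; dilating by `d / 2` and modulating places it
  -- within distance `d` of `lam.seq n`, where there is no other frequency.
  set K : ℝ → ℂ := fun t => jackson (d / 2 * t) * Complex.exp (lam.seq n * (t * Complex.I)) with hKdef
  have hKn : ∀ t, ‖K t‖ = ‖jackson (d / 2 * t)‖ := by
    intro t
    have := norm_exp_neg_mul_ofReal_mul_I (-lam.seq n) t
    rw [Complex.ofReal_neg, neg_neg] at this
    rw [hKdef, norm_mul, this, mul_one]
  have hKc : Continuous K := by
    have := continuous_jackson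
    fun_prop
  have hKi : MeasureTheory.Integrable K :=
    (integrable_jackson.comp_mul_left' hc.ne').mono hKc.aestronglyMeasurable
      (Eventually.of_forall fun t => (hKn t).le)
  have hKw : MeasureTheory.Integrable fun t : ℝ => (1 + |t|) * ‖K t‖ := by
    simp_rw [hKn]
    exact integrable_weight_jackson_comp_mul hc
  have hhat : ∀ x, kernelHat K x
      = ((d / 2 : ℝ) : ℂ)⁻¹ * kernelHat jackson ((x - lam.seq n) / (d / 2)) := by
    intro x
    rw [hKdef, kernelHat_mul_exp (fun t => jackson (d / 2 * t)), kernelHat_comp_mul _ hc]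
  have hzero : ∀ m, m ≠ n → kernelHat K (lam.seq m) = 0 := by
    intro m hm
    rw [hhat, kernelHat_jackson_of_two_le_abs, mul_zero]
    rw [abs_div, abs_of_pos hc, le_div_iff₀ hc]
    linarith [hsep m hm]
  have hint : ∫ t, ‖K t‖ = (d / 2)⁻¹ * ∫ t, ‖jackson t‖ := by
    simp_rw [hKn]
    exact integral_norm_jackson_comp_mul hc
  -- Since `jackson` is nonnegative, its transform at the centre equals the `L¹`-norm, and the final
  -- constant is exactly `1`.
  have hself : kernelHat K (lam.seq n) = ((∫ t, ‖K t‖ : ℝ) : ℂ) := by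
    rw [hhat, sub_self, zero_div, kernelHat_zero_eq_integral_norm jackson_eq_norm, hint]
    push_cast; rfl
  have hpos : 0 < ∫ t, ‖K t‖ := by
    rw [hint]; exact mul_pos (inv_pos.2 hc) integral_norm_jackson_pos
  have key := hf.norm_sum_mul_kernelHat_le hM hKi (hf.dominated_of_integrable_weight hKw)
    (N := n + 1) (fun m hm => hzero m (by omega)) (s := 0) (by simp)
  rw [Finset.sum_range_succ, Finset.sum_eq_zero, zero_add] at key
  · rw [hself, mul_zero, Complex.exp_zero, mul_one, norm_mul, Complex.norm_of_nonneg hpos.le] at key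
    exact le_of_mul_le_mul_right key hpos
  · intro m hm
    rw [hzero m (Finset.mem_range.1 hm).ne, mul_zero, zero_mul]

theorem DExt.norm_coeff_le (D : lam.DExt) (n : ℕ) : ‖D.coeff n‖ ≤ ‖D‖ :=
  D.ext_spec.norm_coeff_le (fun _ hs => D.norm_ext_le hs) n

/-! ### Absolute convergence and completeness -/

/-- For a positive `x` strictly between `L` and `σ`, eventually `log (n + 1) < x * lam.seq n`, so
the terms are dominated by `(n + 1) ^ (-(σ / x))` with `σ / x > 1`. -/
theorem summable_exp_of_L_lt {σ : ℝ} (hσ : 0 < σ) (h : lam.L < (σ : EReal)) :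
    Summable fun n => Real.exp (-(σ * lam.seq n)) := by
  obtain ⟨x, hx1, hx2⟩ := EReal.lt_iff_exists_real_btwn.1
    (max_lt h (EReal.coe_pos.2 hσ))
  have hx0 : 0 < x := EReal.coe_pos.1 ((le_max_right _ _).trans_lt hx1)
  have hxσ : x < σ := EReal.coe_lt_coe_iff.1 hx2
  have hev := eventually_lt_of_limsup_lt ((le_max_left _ _).trans_lt hx1)
  have hpos := lam.tendsto_atTop.eventually_gt_atTop 0
  have hsum : Summable fun n : ℕ => ((n : ℝ) + 1) ^ (-(σ / x)) := by
    have := (Real.summable_nat_rpow (p := -(σ / x))).2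
      (by rw [neg_lt_neg_iff, one_lt_div hx0]; exact hxσ)
    simpa using (summable_nat_add_iff 1).2 this
  refine Summable.of_norm_bounded_eventually_nat hsum ?_
  filter_upwards [hev, hpos] with n hn hp
  have h1 : Real.log ((n : ℝ) + 1) < x * lam.seq n := by
    have := EReal.coe_lt_coe_iff.1 hn
    rwa [div_lt_iff₀ hp] at this
  rw [Real.norm_of_nonneg (Real.exp_pos _).le, Real.rpow_def_of_pos (by positivity)]
  refine Real.exp_le_exp.2 ?_
  have h2 : Real.log ((n : ℝ) + 1) * (σ / x) ≤ x * lam.seq n * (σ / x) :=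
    mul_le_mul_of_nonneg_right h1.le (by positivity)
  have h3 : x * lam.seq n * (σ / x) = σ * lam.seq n := by field_simp
  linarith

theorem tendsto_partialSum_of_summable {σ : ℝ}
    (h : Summable fun n => ‖a n‖ * Real.exp (-(σ * lam.seq n))) {s : ℂ} (hs : σ ≤ s.re) :
    Tendsto (lam.partialSum a s) atTop
      (𝓝 (∑' n, a n * Complex.exp (-(lam.seq n : ℂ) * s))) :=
  (Summable.of_norm_bounded h fun n => norm_term_le hs n).hasSum.tendsto_sum_nat

/-- The extension agrees with the sum of the series wherever the series converges absolutely. -/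
theorem IsBoundedExtension.tendsto_of_summable {f : ℂ → ℂ} (hf : lam.IsBoundedExtension a 0 f)
    {σ : ℝ} (hσ : 0 ≤ σ) (h : Summable fun n => ‖a n‖ * Real.exp (-(σ * lam.seq n))) {s : ℂ}
    (hs : σ < s.re) : Tendsto (lam.partialSum a s) atTop (𝓝 (f s)) := by
  obtain ⟨σ₀, -, hlim⟩ := hf.agrees
  have hd : DifferentiableOn ℂ (fun s => ∑' n, a n * Complex.exp (-(lam.seq n : ℂ) * s))
      {s : ℂ | σ < s.re} :=
    Complex.differentiableOn_tsum_of_summable_norm h (fun n => by fun_prop) (isOpen_re_gt σ)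
      fun n w hw => norm_term_le (le_of_lt hw) n
  have hf' : DifferentiableOn ℂ f {s : ℂ | σ < s.re} :=
    hf.holo.mono fun s hs => hσ.trans_lt hs
  have hz : σ < (((max σ₀ σ + 1 : ℝ) : ℂ)).re := by
    rw [Complex.ofReal_re]; linarith [le_max_right σ₀ σ]
  have e : f s = ∑' n, a n * Complex.exp (-(lam.seq n : ℂ) * s) := by
    refine (hf'.analyticOnNhd (isOpen_re_gt σ)).eqOn_of_preconnected_of_eventuallyEq
      (hd.analyticOnNhd (isOpen_re_gt σ)) (convex_halfSpace_re_gt σ).isPreconnected hz ?_ hs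
    filter_upwards [(isOpen_re_gt (max σ₀ σ)).mem_nhds
      (show max σ₀ σ < (((max σ₀ σ + 1 : ℝ) : ℂ)).re by rw [Complex.ofReal_re]; linarith)]
      with w hw
    exact tendsto_nhds_unique (hlim w ((le_max_left _ _).trans_lt hw))
      (tendsto_partialSum_of_summable h ((le_max_right _ _).trans_lt hw).le)
  rw [e]
  exact tendsto_partialSum_of_summable h hs.le

theorem DExt.ext_sub (D E : lam.DExt) {s : ℂ} (hs : 0 < s.re) :
    (D - E).ext s = D.ext s - E.ext s := by
  rw [eq_sub_iff_add_eq, ← ext_add (D - E) E hs, sub_add_cancel]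

theorem DExt.coeff_sub (D E : lam.DExt) (n : ℕ) : (D - E).coeff n = D.coeff n - E.coeff n := rfl

theorem norm_partialSum_sub_le {σ C : ℝ} {b : ℕ → ℂ}
    (h : ∀ N, ∑ n ∈ Finset.range N, ‖a n - b n‖ * Real.exp (-(σ * lam.seq n)) ≤ C)
    {s : ℂ} (hs : σ ≤ s.re) (N : ℕ) :
    ‖lam.partialSum a s N - lam.partialSum b s N‖ ≤ C := by
  rw [partialSum, partialSum, ← Finset.sum_sub_distrib]
  refine (norm_sum_le _ _).trans (le_trans (Finset.sum_le_sum fun n _ => ?_) (h N))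
  rw [← sub_mul]
  exact norm_term_le (a := fun n => a n - b n) hs n

/-- `D_∞^ext(λ)` is complete if a weighted `ℓ¹`-norm of the coefficients is controlled by the
norm. -/
theorem completeSpace_dExt_of_sum_le {σ C : ℝ} (hσ : 0 ≤ σ)
    (h : ∀ (D : lam.DExt) (N : ℕ),
      ∑ n ∈ Finset.range N, ‖D.coeff n‖ * Real.exp (-(σ * lam.seq n)) ≤ C * ‖D‖) :
    CompleteSpace lam.DExt := by
  have hC : 0 ≤ |C| := abs_nonneg C
  refine Metric.complete_of_cauchySeq_tendsto fun u hu => ?_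
  have hsummable : ∀ D : lam.DExt, Summable fun n => ‖D.coeff n‖ * Real.exp (-(σ * lam.seq n)) :=
    fun D => summable_of_sum_range_le (fun n => by positivity) (h D)
  have hcoeff : ∀ n, ∃ z, Tendsto (fun k => (u k).coeff n) atTop (𝓝 z) := by
    intro n
    refine cauchySeq_tendsto_of_complete (Metric.cauchySeq_iff.2 fun ε hε => ?_)
    obtain ⟨k₀, hk₀⟩ := Metric.cauchySeq_iff.1 hu ε hε
    refine ⟨k₀, fun k hk l hl => lt_of_le_of_lt ?_ (hk₀ k hk l hl)⟩
    rw [dist_eq_norm, dist_eq_norm, ← DExt.coeff_sub]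
    exact DExt.norm_coeff_le _ n
  have hfun : ∀ s : ℂ, ∃ z, 0 < s.re → Tendsto (fun k => (u k).ext s) atTop (𝓝 z) := by
    intro s
    by_cases hs : 0 < s.re
    · obtain ⟨z, hz⟩ := cauchySeq_tendsto_of_complete
        (u := fun k => (u k).ext s) (Metric.cauchySeq_iff.2 fun ε hε => by
          obtain ⟨k₀, hk₀⟩ := Metric.cauchySeq_iff.1 hu ε hε
          refine ⟨k₀, fun k hk l hl => lt_of_le_of_lt ?_ (hk₀ k hk l hl)⟩
          rw [dist_eq_norm, dist_eq_norm, ← DExt.ext_sub _ _ hs]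
          exact DExt.norm_ext_le _ hs)
      exact ⟨z, fun _ => hz⟩
    · exact ⟨0, fun h => absurd h hs⟩
  choose b hb using hcoeff
  choose g hg using hfun
  -- Let the second index of the Cauchy condition tend to infinity; the same is done below for the
  -- weighted coefficient sums.
  have hunif : ∀ ε > 0, ∃ k₀, ∀ k, k₀ ≤ k → ∀ s : ℂ, 0 < s.re → ‖(u k).ext s - g s‖ ≤ ε := by
    intro ε hε
    obtain ⟨k₀, hk₀⟩ := Metric.cauchySeq_iff.1 hu ε hε
    refine ⟨k₀, fun k hk s hs => ?_⟩
    refine le_of_tendsto ((tendsto_const_nhds.sub (hg s hs)).norm) ?_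
    filter_upwards [eventually_ge_atTop k₀] with l hl
    rw [← DExt.ext_sub _ _ hs]
    refine (DExt.norm_ext_le _ hs).trans ?_
    rw [← dist_eq_norm]
    exact (hk₀ k hk l hl).le
  have hsum : ∀ ε > 0, ∃ k₀, ∀ k, k₀ ≤ k → ∀ N, ∑ n ∈ Finset.range N,
      ‖(u k).coeff n - b n‖ * Real.exp (-(σ * lam.seq n)) ≤ |C| * ε := by
    intro ε hε
    obtain ⟨k₀, hk₀⟩ := Metric.cauchySeq_iff.1 hu ε hε
    refine ⟨k₀, fun k hk N => ?_⟩
    refine le_of_tendsto (tendsto_finsetSum (Finset.range N) fun n _ =>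
      ((tendsto_const_nhds.sub (hb n)).norm.mul_const _)) ?_
    filter_upwards [eventually_ge_atTop k₀] with l hl
    refine (h (u k - u l) N).trans ?_
    have := (hk₀ k hk l hl).le
    rw [dist_eq_norm] at this
    exact (mul_le_mul_of_nonneg_right (le_abs_self C) (norm_nonneg _)).trans
      (mul_le_mul_of_nonneg_left this hC)
  have hext : lam.IsBoundedExtension b 0 g := by
    refine ⟨?_, ?_, ?_⟩
    · have hloc : TendstoUniformlyOn (fun k => (u k).ext) g atTop {s : ℂ | 0 < s.re} := by
        rw [Metric.tendstoUniformlyOn_iff]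
        intro ε hε
        obtain ⟨k₀, hk₀⟩ := hunif (ε / 2) (half_pos hε)
        filter_upwards [eventually_ge_atTop k₀] with k hk s hs
        rw [dist_comm, dist_eq_norm]
        exact (hk₀ k hk s hs).trans_lt (half_lt_self hε)
      exact hloc.tendstoLocallyUniformlyOn.differentiableOn
        (Eventually.of_forall fun k => (u k).ext_spec.holo) (isOpen_re_gt 0)
    · obtain ⟨k₀, hk₀⟩ := hunif 1 one_pos
      refine ⟨‖u k₀‖ + 1, fun s hs => ?_⟩
      have h1 := hk₀ k₀ le_rfl s hs
      have h2 := (u k₀).norm_ext_le hs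
      have h3 := norm_le_norm_add_norm_sub' (g s) ((u k₀).ext s)
      rw [norm_sub_rev] at h3
      linarith
    -- The series of limit coefficients must sum to `g`. One fixed `u k` is compared with both: its
    -- partial sums are close to those of `b` uniformly in `N`, and its extension is close to `g`.
    · refine ⟨σ, hσ, fun s hs => ?_⟩
      have hs0 : 0 < s.re := hσ.trans_lt hs
      rw [Metric.tendsto_atTop]
      intro ε hε
      set η : ℝ := ε / (3 * (|C| + 1)) with hη
      have hη0 : 0 < η := by positivity
      have hη1 : (|C| + 1) * η = ε / 3 := by rw [hη]; field_simp
      obtain ⟨k₁, hk₁⟩ := hunif η hη0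
      obtain ⟨k₂, hk₂⟩ := hsum η hη0
      set k := max k₁ k₂
      have h1 := hk₁ k (le_max_left _ _) s hs0
      have h2 := norm_partialSum_sub_le (hk₂ k (le_max_right _ _)) hs.le
      obtain ⟨N₀, hN₀⟩ := Metric.tendsto_atTop.1
        ((u k).ext_spec.tendsto_of_summable hσ (hsummable (u k)) hs) (ε / 3) (by positivity)
      refine ⟨N₀, fun N hN => ?_⟩
      have h3 := hN₀ N hN
      have h4 := h2 N
      rw [dist_eq_norm] at h3 ⊢
      have e : lam.partialSum b s N - g s
          = -(lam.partialSum (u k).coeff s N - lam.partialSum b s N)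
            + (lam.partialSum (u k).coeff s N - (u k).ext s) + ((u k).ext s - g s) := by ring
      rw [e]
      have h5 := norm_add₃_le (a := -(lam.partialSum (u k).coeff s N - lam.partialSum b s N))
        (b := lam.partialSum (u k).coeff s N - (u k).ext s) (c := (u k).ext s - g s)
      rw [norm_neg] at h5
      have h6 : |C| * η + η = ε / 3 := by rw [← hη1]; ring
      linarith
  refine ⟨(⟨b, g, hext⟩ : lam.extSubmodule), ?_⟩
  set D : lam.DExt := (⟨b, g, hext⟩ : lam.extSubmodule) with hD
  rw [Metric.tendsto_atTop]
  intro ε hε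
  obtain ⟨k₀, hk₀⟩ := hunif (ε / 2) (half_pos hε)
  refine ⟨k₀, fun k hk => lt_of_le_of_lt ?_ (half_lt_self hε)⟩
  rw [dist_eq_norm]
  refine DExt.norm_le _ fun s hs => ?_
  have hDg : D.ext s = g s := D.ext_spec.unique hext hs
  rw [DExt.ext_sub _ _ hs, hDg]
  exact hk₀ k hk s hs

theorem exists_summable_exp_of_L_lt_top (h : lam.L < ⊤) :
    ∃ σ : ℝ, 0 ≤ σ ∧ Summable fun n => Real.exp (-(σ * lam.seq n)) := by
  obtain ⟨x, hx, -⟩ := EReal.lt_iff_exists_real_btwn.1 h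
  refine ⟨max x 1, zero_le_one.trans (le_max_right _ _), summable_exp_of_L_lt
    (zero_lt_one.trans_le (le_max_right _ _)) (hx.trans_le ?_)⟩
  exact EReal.coe_le_coe_iff.2 (le_max_left _ _)

theorem completeSpace_dExt_of_L_lt_top (h : lam.L < ⊤) : CompleteSpace lam.DExt := by
  obtain ⟨σ, hσ, hs⟩ := exists_summable_exp_of_L_lt_top h
  refine completeSpace_dExt_of_sum_le (C := ∑' n, Real.exp (-(σ * lam.seq n))) hσ fun D N => ?_
  refine (Finset.sum_le_sum fun n _ => mul_le_mul_of_nonneg_right (D.norm_coeff_le n)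
    (Real.exp_pos _).le).trans ?_
  rw [← Finset.mul_sum, mul_comm]
  exact mul_le_mul_of_nonneg_right (hs.sum_le_tsum _ fun n _ => (Real.exp_pos _).le)
    (norm_nonneg _)

/-- The hypothesis makes the subspace all of `DExt`, hence closed in a complete space. -/
theorem completeSpace_dInf_of_forall_convergesAt (hc : CompleteSpace lam.DExt)
    (h : ∀ (D : lam.DExt) (s : ℂ), 0 < s.re → lam.ConvergesAt D.coeff s) :
    CompleteSpace lam.DInf := by
  have htop : (lam.DInf : Set lam.DExt) = Set.univ := Set.eq_univ_of_forall fun D => h D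
  have : IsClosed (lam.DInf : Set lam.DExt) := by rw [htop]; exact isClosed_univ
  exact this.completeSpace_coe

theorem completeSpace_dInf_of_L_eq_zero (h : lam.L = 0) : CompleteSpace lam.DInf := by
  refine completeSpace_dInf_of_forall_convergesAt
    (completeSpace_dExt_of_L_lt_top (by rw [h]; exact EReal.zero_lt_top)) fun D s hs => ?_
  have h1 := summable_exp_of_L_lt (lam := lam) hs (by rw [h]; exact EReal.coe_pos.2 hs)
  refine ⟨_, tendsto_partialSum_of_summable (σ := s.re)
    (Summable.of_nonneg_of_le (fun n => by positivity) (fun n => ?_) (h1.mul_left ‖D‖)) le_rfl⟩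
  exact mul_le_mul_of_nonneg_right (D.norm_coeff_le n) (Real.exp_pos _).le

theorem completeSpace_dInf_of_convergesWhereExtendable (h : lam.ConvergesWhereExtendable)
    (hL : lam.L < ⊤) : CompleteSpace lam.DInf := by
  refine completeSpace_dInf_of_forall_convergesAt (completeSpace_dExt_of_L_lt_top hL)
    fun D s hs => ?_
  obtain ⟨σ₀, -, hlim⟩ := D.ext_spec.agrees
  have h1 := h D.coeff ⟨((σ₀ + 1 : ℝ) : ℂ), _, hlim _ (by rw [Complex.ofReal_re]; linarith)⟩
  have h2 : lam.sigmaBExt D.coeff ≤ ((0 : ℝ) : EReal) := sInf_le ⟨0, rfl, D.ext, D.ext_spec⟩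
  have h3 : lam.sigmaC D.coeff < (s.re : EReal) :=
    (h1.trans h2).trans_lt (EReal.coe_lt_coe_iff.2 hs)
  obtain ⟨_, ⟨σ, rfl, hσ⟩, hlt⟩ := sInf_lt_iff.1 h3
  exact hσ s (EReal.coe_lt_coe_iff.1 hlt)

end Frequency

/-! ### Trapezoidal kernels and Landau's condition -/

theorem kernelHat_const_mul (c : ℂ) (K : ℝ → ℂ) (x : ℝ) :
    kernelHat (fun t => c * K t) x = c * kernelHat K x := by
  rw [kernelHat, kernelHat, ← MeasureTheory.integral_const_mul]
  simp_rw [mul_assoc]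

theorem kernelHat_sub {K J : ℝ → ℂ} (hK : MeasureTheory.Integrable K)
    (hJ : MeasureTheory.Integrable J) (x : ℝ) :
    kernelHat (fun t => K t - J t) x = kernelHat K x - kernelHat J x := by
  rw [kernelHat, kernelHat, kernelHat,
    ← MeasureTheory.integral_sub (integrable_kernel_mul_exp hK x) (integrable_kernel_mul_exp hJ x)]
  simp_rw [sub_mul]

theorem integrable_sq_mul_fejer (c : ℝ) :
    MeasureTheory.Integrable fun t => (c : ℂ) ^ 2 * fejer (c * t) := by
  rcases eq_or_ne c 0 with rfl | hc
  · simp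
  · exact (integrable_fejer.comp_mul_left' hc).const_mul _

theorem kernelHat_sq_mul_fejer {c : ℝ} (hc : 0 ≤ c) (x : ℝ) :
    kernelHat (fun t => (c : ℂ) ^ 2 * fejer (c * t)) x
      = 2 * Real.pi * ((max 0 (c - |x|) : ℝ) : ℂ) := by
  rcases hc.eq_or_lt with rfl | hc
  · simp [kernelHat]
  · rw [kernelHat_const_mul, kernelHat_comp_mul _ hc, kernelHat_fejer, tent]
    have e : max 0 (c - |x|) = c * max 0 (1 - |x / c|) := by
      rw [mul_max_of_nonneg _ _ hc.le, mul_zero, mul_sub, abs_div, abs_of_pos hc, mul_one,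
        mul_div_cancel₀ _ hc.ne']
    have hc' : (c : ℂ) ≠ 0 := by exact_mod_cast hc.ne'
    rw [e]
    push_cast
    field_simp

/-- The kernel whose transform is `1` on `[-a, a]`, `0` outside `[-b, b]` and affine in between. -/
noncomputable def trapezoidKernel (a b t : ℝ) : ℂ :=
  ((2 * Real.pi * (b - a) : ℝ) : ℂ)⁻¹ *
    ((b : ℂ) ^ 2 * fejer (b * t) - (a : ℂ) ^ 2 * fejer (a * t))

theorem integrable_trapezoidKernel (a b : ℝ) : MeasureTheory.Integrable (trapezoidKernel a b) :=
  ((integrable_sq_mul_fejer b).sub (integrable_sq_mul_fejer a)).const_mul _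

theorem kernelHat_trapezoidKernel {a b : ℝ} (ha : 0 ≤ a) (hab : a < b) (x : ℝ) :
    kernelHat (trapezoidKernel a b) x
      = (((max 0 (b - |x|) - max 0 (a - |x|)) / (b - a) : ℝ) : ℂ) := by
  have h : kernelHat (trapezoidKernel a b) x = ((2 * Real.pi * (b - a) : ℝ) : ℂ)⁻¹ *
      kernelHat (fun t => (b : ℂ) ^ 2 * fejer (b * t) - (a : ℂ) ^ 2 * fejer (a * t)) x :=
    kernelHat_const_mul _ _ _
  rw [h, kernelHat_sub (integrable_sq_mul_fejer b) (integrable_sq_mul_fejer a),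
    kernelHat_sq_mul_fejer (ha.trans hab.le), kernelHat_sq_mul_fejer ha]
  have h1 : ((b : ℂ) - a) ≠ 0 := by
    rw [← Complex.ofReal_sub]; exact_mod_cast (sub_pos.2 hab).ne'
  have h2 : (Real.pi : ℂ) ≠ 0 := by exact_mod_cast Real.pi_ne_zero
  push_cast
  field_simp

theorem kernelHat_trapezoidKernel_of_abs_le {a b : ℝ} (hab : a < b) {x : ℝ} (hx : |x| ≤ a) :
    kernelHat (trapezoidKernel a b) x = 1 := by
  rw [kernelHat_trapezoidKernel ((abs_nonneg x).trans hx) hab, max_eq_right (by linarith),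
    max_eq_right (by linarith), sub_sub_sub_cancel_right, div_self (sub_pos.2 hab).ne',
    Complex.ofReal_one]

theorem kernelHat_trapezoidKernel_of_le_abs {a b : ℝ} (ha : 0 ≤ a) (hab : a < b) {x : ℝ}
    (hx : b ≤ |x|) : kernelHat (trapezoidKernel a b) x = 0 := by
  rw [kernelHat_trapezoidKernel ha hab, max_eq_left (by linarith), max_eq_left (by linarith)]
  simp

theorem fejer_neg (t : ℝ) : fejer (-t) = fejer t := by
  rw [fejer, fejer, neg_div, Real.sinc_neg]

theorem trapezoidKernel_abs (a b t : ℝ) : trapezoidKernel a b |t| = trapezoidKernel a b t := by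
  rcases abs_choice t with h | h <;> rw [h]
  rw [trapezoidKernel, trapezoidKernel, mul_neg, mul_neg, fejer_neg, fejer_neg]

theorem sq_mul_fejer (c : ℝ) {t : ℝ} (ht : t ≠ 0) :
    (c : ℂ) ^ 2 * fejer (c * t) = ((4 * Real.sin (c * t / 2) ^ 2 / t ^ 2 : ℝ) : ℂ) := by
  rcases eq_or_ne c 0 with rfl | hc
  · simp
  · rw [fejer, Real.sinc_of_ne_zero (by positivity), ← Complex.ofReal_pow, ← Complex.ofReal_mul]
    congr 1
    field_simp
    ring

/-- Adding `|sin u| ≤ v` and `|sin u| * v ≤ v` gives one rational bound that serves for small and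
large arguments alike. -/
theorem abs_sin_mul_one_add_le {u v : ℝ} (hu : 0 ≤ u) (huv : u ≤ v) :
    |Real.sin u| * (1 + v) ≤ 2 * v := by
  have h1 : |Real.sin u| ≤ u := by
    have := Real.abs_sin_le_abs (x := u)
    rwa [abs_of_nonneg hu] at this
  have h2 : |Real.sin u| * v ≤ 1 * v :=
    mul_le_mul_of_nonneg_right (Real.abs_sin_le_one u) (hu.trans huv)
  linarith

/-- The difference of two squared sines factors as `sin ((a + b) / 2 * t) * sin ((b - a) / 2 * t)`.
The majorant is written in partial fractions so that its integral is a difference of logarithms. -/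
theorem norm_trapezoidKernel_le {a b : ℝ} (ha : 0 ≤ a) (hab : a < b) {t : ℝ} (ht : 0 < t) :
    ‖trapezoidKernel a b t‖
      ≤ 8 * (b / (1 + b * t) - (b - a) / 2 / (1 + (b - a) / 2 * t)) := by
  have hb : 0 < b := ha.trans_lt hab
  have hp : 0 < b - a := sub_pos.2 hab
  have hsin : Real.sin (b * t / 2) ^ 2 - Real.sin (a * t / 2) ^ 2
      = Real.sin ((a + b) / 2 * t) * Real.sin ((b - a) / 2 * t) := by
    have e1 : (a + b) / 2 * t = b * t / 2 + a * t / 2 := by ring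
    have e2 : (b - a) / 2 * t = b * t / 2 - a * t / 2 := by ring
    rw [e1, e2, Real.sin_add, Real.sin_sub]
    have := Real.sin_sq_add_cos_sq (b * t / 2)
    have := Real.sin_sq_add_cos_sq (a * t / 2)
    have hb' : Real.cos (b * t / 2) ^ 2 = 1 - Real.sin (b * t / 2) ^ 2 := by linarith
    have ha' : Real.cos (a * t / 2) ^ 2 = 1 - Real.sin (a * t / 2) ^ 2 := by linarith
    linear_combination Real.sin (a * t / 2) ^ 2 * hb' - Real.sin (b * t / 2) ^ 2 * ha'
  have e : trapezoidKernel a b t = ((2 / (Real.pi * (b - a) * t ^ 2) *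
      (Real.sin ((a + b) / 2 * t) * Real.sin ((b - a) / 2 * t)) : ℝ) : ℂ) := by
    rw [trapezoidKernel, sq_mul_fejer _ ht.ne', sq_mul_fejer _ ht.ne', ← Complex.ofReal_inv,
      ← Complex.ofReal_sub, ← Complex.ofReal_mul, ← hsin]
    congr 1
    field_simp
    ring
  rw [e, Complex.norm_real, Real.norm_eq_abs, abs_mul, abs_mul, abs_of_pos (by positivity)]
  have h1 := abs_sin_mul_one_add_le (u := (a + b) / 2 * t) (v := b * t) (by positivity)
    (mul_le_mul_of_nonneg_right (by linarith) ht.le)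
  have h2 := abs_sin_mul_one_add_le (u := (b - a) / 2 * t) (by positivity) le_rfl
  have hq1 : 0 < 1 + b * t := by positivity
  have hq2 : 0 < 1 + (b - a) / 2 * t := by positivity
  rw [← le_div_iff₀ hq1] at h1
  rw [← le_div_iff₀ hq2] at h2
  calc 2 / (Real.pi * (b - a) * t ^ 2) *
        (|Real.sin ((a + b) / 2 * t)| * |Real.sin ((b - a) / 2 * t)|)
      ≤ 2 / (1 * (b - a) * t ^ 2) *
        (2 * (b * t) / (1 + b * t) * (2 * ((b - a) / 2 * t) / (1 + (b - a) / 2 * t))) := by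
        gcongr
        linarith [Real.pi_gt_three]
    _ = 4 * b / ((1 + b * t) * (1 + (b - a) / 2 * t)) := by
        field_simp
        norm_num
    -- The numerator is enlarged to a multiple of `(a + b) / 2 = b - (b - a) / 2`, exactly what the
    -- partial fractions produce.
    _ ≤ 8 * ((a + b) / 2) / ((1 + b * t) * (1 + (b - a) / 2 * t)) := by
        refine div_le_div_of_nonneg_right ?_ (by positivity)
        linarith
    _ = _ := by field_simp; ring

/-- The kernel is even, and on the positive half-line the majorant has antiderivative `8 * (log (1 +
b t) - log (1 + (b - a) / 2 * t))`, which runs from `0` to `8 * log (2 b / (b - a))`. -/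
theorem integral_norm_trapezoidKernel_le {a b : ℝ} (ha : 0 ≤ a) (hab : a < b) :
    ∫ t, ‖trapezoidKernel a b t‖ ≤ 16 * Real.log (2 * b / (b - a)) := by
  have hb : 0 < b := ha.trans_lt hab
  have hp : 0 < b - a := sub_pos.2 hab
  have hderiv : ∀ t ∈ Set.Ici (0 : ℝ), HasDerivAt
      (fun t => Real.log (1 + b * t) - Real.log (1 + (b - a) / 2 * t))
      (b / (1 + b * t) - (b - a) / 2 / (1 + (b - a) / 2 * t)) t := by
    intro t ht
    have ht' : 0 ≤ t := ht
    have h1 : ∀ c : ℝ, 0 < c → HasDerivAt (fun t => Real.log (1 + c * t)) (c / (1 + c * t)) t := by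
      intro c hc
      have := (((hasDerivAt_id t).const_mul c).const_add 1).log
        (show (1 + c * id t) ≠ 0 by have := mul_nonneg hc.le ht'; simp only [id]; positivity)
      simpa using this
    exact (h1 b hb).sub (h1 ((b - a) / 2) (by positivity))
  have hnonneg : ∀ t ∈ Set.Ioi (0 : ℝ),
      0 ≤ b / (1 + b * t) - (b - a) / 2 / (1 + (b - a) / 2 * t) := by
    intro t ht
    have := (norm_nonneg _).trans (norm_trapezoidKernel_le ha hab ht)
    linarith
  have hlim : Tendsto (fun t => Real.log (1 + b * t) - Real.log (1 + (b - a) / 2 * t)) atTop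
      (𝓝 (Real.log (2 * b / (b - a)))) := by
    have h0 : Tendsto (fun t : ℝ => (t⁻¹ + b) / (t⁻¹ + (b - a) / 2)) atTop
        (𝓝 ((0 + b) / (0 + (b - a) / 2))) :=
      (tendsto_inv_atTop_zero.add_const b).div (tendsto_inv_atTop_zero.add_const _)
        (by positivity)
    have e : (0 + b) / (0 + (b - a) / 2) = 2 * b / (b - a) := by field_simp; ring
    rw [e] at h0
    refine (h0.log (by positivity)).congr' ?_
    filter_upwards [eventually_gt_atTop 0] with t ht
    rw [← Real.log_div (by positivity) (by positivity)]
    congr 1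
    field_simp
  have hint := MeasureTheory.integrableOn_Ioi_deriv_of_nonneg' hderiv hnonneg hlim
  have hval := MeasureTheory.integral_Ioi_of_hasDerivAt_of_nonneg' hderiv hnonneg hlim
  have habs : ∫ t, ‖trapezoidKernel a b t‖
      = 2 * ∫ t in Set.Ioi (0 : ℝ), ‖trapezoidKernel a b t‖ := by
    rw [← integral_comp_abs (f := fun t => ‖trapezoidKernel a b t‖)]
    simp_rw [trapezoidKernel_abs]
  have hle : ∫ t in Set.Ioi (0 : ℝ), ‖trapezoidKernel a b t‖
      ≤ ∫ t in Set.Ioi (0 : ℝ), 8 * (b / (1 + b * t) - (b - a) / 2 / (1 + (b - a) / 2 * t)) :=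
    MeasureTheory.setIntegral_mono_on (integrable_trapezoidKernel a b).norm.integrableOn
      (hint.const_mul 8) measurableSet_Ioi fun t ht => norm_trapezoidKernel_le ha hab ht
  rw [MeasureTheory.integral_const_mul, hval] at hle
  simp only [mul_zero, add_zero, Real.log_one, sub_zero] at hle
  rw [habs]
  linarith

namespace Frequency

variable {lam : Frequency} {a : ℕ → ℂ}

/-- No frequency lies strictly between `lam.seq N` and `lam.seq (N + 1)`, so a trapezoid sloping
there acts as a sharp cutoff. Its kernel decays only quadratically, too slowly for the linear
weight; `L < ⊤` supplies the absolute convergence used instead. -/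
theorem IsBoundedExtension.norm_sum_coeff_le {f : ℂ → ℂ} (hf : lam.IsBoundedExtension a 0 f)
    {M : ℝ} (hM : ∀ s : ℂ, 0 < s.re → ‖f s‖ ≤ M) (hL : lam.L < ⊤) (N : ℕ) :
    ‖lam.partialSum a 0 (N + 1)‖
      ≤ M * (16 * Real.log (2 * lam.seq (N + 1) / (lam.seq (N + 1) - lam.seq N))) := by
  have hM0 : 0 ≤ M := (norm_nonneg _).trans (hM 1 (by simp))
  have hlt : lam.seq N < lam.seq (N + 1) := lam.strictMono (Nat.lt_succ_self N)
  obtain ⟨σ, hσ, hs⟩ := exists_summable_exp_of_L_lt_top hL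
  have hsum : Summable fun n => ‖a n‖ * Real.exp (-(σ * lam.seq n)) :=
    Summable.of_nonneg_of_le (fun n => by positivity)
      (fun n => mul_le_mul_of_nonneg_right (hf.norm_coeff_le hM n) (Real.exp_pos _).le)
      (hs.mul_left M)
  have hK := integrable_trapezoidKernel (lam.seq N) (lam.seq (N + 1))
  have key := hf.norm_sum_mul_kernelHat_le hM hK (dominated_of_summable hsum hK) (N := N + 1)
    (fun n hn => kernelHat_trapezoidKernel_of_le_abs (lam.nonneg N) hlt
      ((lam.strictMono.monotone hn).trans (le_abs_self _))) (s := 0) (by simp)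
  have e : ∑ n ∈ Finset.range (N + 1), a n *
      kernelHat (trapezoidKernel (lam.seq N) (lam.seq (N + 1))) (lam.seq n) *
        Complex.exp (-(lam.seq n : ℂ) * 0) = lam.partialSum a 0 (N + 1) := by
    refine Finset.sum_congr rfl fun n hn => ?_
    rw [kernelHat_trapezoidKernel_of_abs_le hlt, mul_one]
    rw [abs_of_nonneg (lam.nonneg n)]
    exact lam.strictMono.monotone (Nat.le_of_lt_succ (Finset.mem_range.1 hn))
  rw [e] at key
  exact key.trans (mul_le_mul_of_nonneg_left
    (integral_norm_trapezoidKernel_le (lam.nonneg N) hlt) hM0)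

/-! ### Consequences of (LC) and (BC) -/

theorem LC.exists_log_le (h : lam.LC) {δ : ℝ} (hδ : 0 < δ) :
    ∃ B : ℝ, ∀ n, Real.log (2 * lam.seq (n + 1) / (lam.seq (n + 1) - lam.seq n))
      ≤ B * Real.exp (δ * lam.seq n) := by
  obtain ⟨C, hC, hgap⟩ := h δ hδ
  -- The first two summands come from `log y ≤ y - 1` at `y = 2 + 2 * x / C`, the last from the
  -- logarithm of the double exponential.
  refine ⟨1 + 2 / (C * δ) + 1, fun n => ?_⟩
  have hx := lam.nonneg n
  set x := lam.seq n
  have hp : 0 < lam.seq (n + 1) - x := sub_pos.2 (lam.strictMono (Nat.lt_succ_self n))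
  set p := lam.seq (n + 1) - x with hpdef
  have hE : 1 ≤ Real.exp (δ * x) := Real.one_le_exp (by positivity)
  have hEx : δ * x ≤ Real.exp (δ * x) := by linarith [Real.add_one_le_exp (δ * x)]
  have hEE : 1 ≤ Real.exp (Real.exp (δ * x)) := Real.one_le_exp (by positivity)
  have h1 : 1 / p ≤ Real.exp (Real.exp (δ * x)) / C := by
    rw [div_le_div_iff₀ hp hC, one_mul]
    have := hgap n
    rw [Real.exp_neg] at this
    rw [← div_eq_mul_inv, div_le_iff₀ (Real.exp_pos _)] at this
    linarith
  have h2 : 2 * lam.seq (n + 1) / p ≤ (2 + 2 * x / C) * Real.exp (Real.exp (δ * x)) := by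
    have e : 2 * lam.seq (n + 1) / p = 2 + 2 * x * (1 / p) := by
      have : lam.seq (n + 1) = p + x := by rw [hpdef]; ring
      rw [this]; field_simp
    rw [e, add_mul]
    have := mul_le_mul_of_nonneg_left h1 (show 0 ≤ 2 * x by positivity)
    have e2 : 2 * x * (Real.exp (Real.exp (δ * x)) / C)
      = 2 * x / C * Real.exp (Real.exp (δ * x)) := by ring
    linarith
  have hpos : 0 < 2 * lam.seq (n + 1) / p := by
    have : 0 < lam.seq (n + 1) := by linarith
    positivity
  calc Real.log (2 * lam.seq (n + 1) / p)
      ≤ Real.log ((2 + 2 * x / C) * Real.exp (Real.exp (δ * x))) := Real.log_le_log hpos h2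
    _ = Real.log (2 + 2 * x / C) + Real.exp (δ * x) := by
        rw [Real.log_mul (by positivity) (Real.exp_pos _).ne', Real.log_exp]
    _ ≤ (2 + 2 * x / C - 1) + Real.exp (δ * x) := by
        gcongr; exact Real.log_le_sub_one_of_pos (by positivity)
    _ = 1 + 2 / (C * δ) * (δ * x) + Real.exp (δ * x) := by field_simp; ring
    _ ≤ 1 * Real.exp (δ * x) + 2 / (C * δ) * Real.exp (δ * x) + Real.exp (δ * x) := by
        gcongr; linarith
    _ = _ := by ring

/-- (LC) with `δ = s.re / 2` makes the coefficient sums `O(exp (δ λₙ))`, and Abel summation then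
converges at `s`. -/
theorem IsBoundedExtension.convergesAt_of_LC {f : ℂ → ℂ} (hf : lam.IsBoundedExtension a 0 f)
    (h : lam.LC) (hL : lam.L < ⊤) {s : ℂ} (hs : 0 < s.re) : lam.ConvergesAt a s := by
  obtain ⟨M, hM⟩ := hf.bdd
  have hM0 : 0 ≤ M := (norm_nonneg _).trans (hM 1 (by simp))
  obtain ⟨B, hB⟩ := h.exists_log_le (half_pos hs)
  refine convergesAt_of_sum_coeff_le (B := M * (16 * B)) (half_pos hs).le (half_lt_self hs)
    fun n => (hf.norm_sum_coeff_le hM hL n).trans ?_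
  rw [mul_assoc, mul_assoc]
  exact mul_le_mul_of_nonneg_left (mul_le_mul_of_nonneg_left (hB n) (by norm_num)) hM0

/-- Translating a Dirichlet series and its extension. -/
theorem IsBoundedExtension.translate {f : ℂ → ℂ} {σ : ℝ} (hf : lam.IsBoundedExtension a σ f) :
    lam.IsBoundedExtension (fun n => a n * Complex.exp (-(lam.seq n : ℂ) * σ)) 0
      (fun s => f (σ + s)) where
  holo := hf.holo.comp (by fun_prop) fun s hs => by
    have : 0 < s.re := hs
    simpa using this
  bdd := by
    obtain ⟨C, hC⟩ := hf.bdd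
    exact ⟨C, fun s hs => hC _ (by simpa using hs)⟩
  agrees := by
    obtain ⟨σ₀, hσ₀, h⟩ := hf.agrees
    refine ⟨σ₀ - σ, sub_nonneg.2 hσ₀, fun s hs => ?_⟩
    refine (h (σ + s) ?_).congr fun N => lam.partialSum_shift a σ s N
    simp only [Complex.add_re, Complex.ofReal_re]
    linarith

theorem LC.convergesWhereExtendable (h : lam.LC) (hL : lam.L < ⊤) :
    lam.ConvergesWhereExtendable := by
  intro a _
  refine le_sInf ?_
  rintro _ ⟨σ, rfl, f, hf⟩
  refine sInf_le ⟨σ, rfl, fun s hs => ?_⟩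
  obtain ⟨z, hz⟩ := hf.translate.convergesAt_of_LC h hL (s := s - σ) (by simpa using hs)
  refine ⟨z, hz.congr fun N => ?_⟩
  rw [← partialSum_shift, add_sub_cancel]

theorem BC.LC (h : lam.BC) : lam.LC := by
  obtain ⟨l, hl, hBC⟩ := h
  obtain ⟨C, hC, hgap⟩ := hBC 1 one_pos
  intro δ hδ
  -- Completing the square, `(l + 1) x ≤ (l + 1)² / (2 δ²) + (δ x)² / 2`, and the last term is at
  -- most `exp (δ x)`.
  refine ⟨C * Real.exp (-((l + 1) ^ 2 / (2 * δ ^ 2))), by positivity, fun n => ?_⟩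
  refine le_trans ?_ (hgap n)
  rw [mul_assoc, ← Real.exp_add]
  refine mul_le_mul_of_nonneg_left (Real.exp_le_exp.2 ?_) hC.le
  have hx := lam.nonneg n
  set x := lam.seq n
  have h1 : (δ * x) ^ 2 / 2 ≤ Real.exp (δ * x) := by
    have := Real.quadratic_le_exp_of_nonneg (show 0 ≤ δ * x by positivity)
    have : 0 ≤ δ * x := by positivity
    linarith
  have h2 : 0 ≤ ((l + 1) / δ - δ * x) ^ 2 := sq_nonneg _
  have e : ((l + 1) / δ - δ * x) ^ 2 = (l + 1) ^ 2 / δ ^ 2 - 2 * (l + 1) * x + (δ * x) ^ 2 := by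
    field_simp; ring
  have e2 : (l + 1) ^ 2 / (2 * δ ^ 2) = (l + 1) ^ 2 / δ ^ 2 / 2 := by field_simp
  rw [e2]
  linarith

theorem BC.L_lt_top (h : lam.BC) : lam.L < ⊤ := by
  obtain ⟨l, hl, hBC⟩ := h
  obtain ⟨C, hC, hgap⟩ := hBC 1 one_pos
  -- The first `N` gaps fit into `[0, lam.seq N]`, and each is at least the lower bound taken at
  -- `lam.seq N`.
  have hcount : ∀ N : ℕ, (N : ℝ) * (C * Real.exp (-(l + 1) * lam.seq N)) ≤ lam.seq N := by
    intro N
    have h1 : ∑ n ∈ Finset.range N, (lam.seq (n + 1) - lam.seq n) ≤ lam.seq N := by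
      rw [Finset.sum_range_sub]; linarith [lam.nonneg 0]
    refine le_trans ?_ h1
    rw [← nsmul_eq_mul, ← Finset.card_range N, ← Finset.sum_const, Finset.card_range]
    refine Finset.sum_le_sum fun n hn => le_trans ?_ (hgap n)
    refine mul_le_mul_of_nonneg_left (Real.exp_le_exp.2 ?_) hC.le
    have := lam.strictMono.monotone (Finset.mem_range.1 hn).le
    nlinarith
  -- Of `l + 3`, one unit beyond `l + 1` pays for the factor `lam.seq N ≤ exp (lam.seq N)`, the
  -- other for the constant `log 2 - log C`.
  have hbound : ∀ᶠ N : ℕ in atTop,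
      ((Real.log ((N : ℝ) + 1) / lam.seq N : ℝ) : EReal) ≤ ((l + 3 : ℝ) : EReal) := by
    filter_upwards [lam.tendsto_atTop.eventually_ge_atTop (max 1 (Real.log 2 - Real.log C)),
      eventually_ge_atTop 1] with N hN hN1
    have hx1 : 1 ≤ lam.seq N := (le_max_left _ _).trans hN
    have hx2 : Real.log 2 - Real.log C ≤ lam.seq N := (le_max_right _ _).trans hN
    have hN' : (1 : ℝ) ≤ N := by exact_mod_cast hN1
    rw [EReal.coe_le_coe_iff, div_le_iff₀ (by linarith)]
    have h1 : (N : ℝ) * C ≤ Real.exp ((l + 2) * lam.seq N) := by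
      have h2 := mul_le_mul_of_nonneg_right (hcount N) (Real.exp_pos ((l + 1) * lam.seq N)).le
      have e : (N : ℝ) * (C * Real.exp (-(l + 1) * lam.seq N)) * Real.exp ((l + 1) * lam.seq N)
          = N * C := by
        rw [mul_assoc, mul_assoc C, ← Real.exp_add, neg_mul, neg_add_cancel, Real.exp_zero, mul_one]
      rw [e] at h2
      refine h2.trans ?_
      have h3 : lam.seq N ≤ Real.exp (lam.seq N) := by linarith [Real.add_one_le_exp (lam.seq N)]
      refine (mul_le_mul_of_nonneg_right h3 (Real.exp_pos _).le).trans (le_of_eq ?_)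
      rw [← Real.exp_add]; congr 1; ring
    have h2 : Real.log N + Real.log C ≤ (l + 2) * lam.seq N := by
      rw [← Real.log_mul (by positivity) hC.ne', ← Real.log_exp ((l + 2) * lam.seq N)]
      exact Real.log_le_log (by positivity) h1
    have h3 : Real.log ((N : ℝ) + 1) ≤ Real.log 2 + Real.log N := by
      rw [← Real.log_mul two_ne_zero (by positivity)]
      exact Real.log_le_log (by positivity) (by linarith)
    linarith
  exact (limsup_le_of_le (by isBoundedDefault) hbound).trans_lt (EReal.coe_lt_top _)

end Frequency

/-! ### Means of almost periodic functions and `ℚ`-independent frequencies -/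

/-- A bounded continuous function `g` has mean `m` (with respect to Fejér averages). -/
structure HasFejerMean (g : ℝ → ℂ) (m : ℂ) : Prop where
  cont : Continuous g
  bdd : ∃ C : ℝ, ∀ t, ‖g t‖ ≤ C
  lim : Tendsto (fun c : ℝ => ∫ t, ((c / (2 * Real.pi) : ℝ) : ℂ) * fejer (c * t) * g t)
    (𝓝[>] 0) (𝓝 m)

theorem integrable_fejer_mul {c : ℝ} (hc : 0 < c) {g : ℝ → ℂ} (hg : Continuous g)
    (hb : ∃ C : ℝ, ∀ t, ‖g t‖ ≤ C) :
    MeasureTheory.Integrable fun t => ((c / (2 * Real.pi) : ℝ) : ℂ) * fejer (c * t) * g t := by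
  obtain ⟨C, hC⟩ := hb
  exact ((integrable_fejer.comp_mul_left' hc.ne').const_mul _).mul_bdd (c := C)
    hg.aestronglyMeasurable (Eventually.of_forall hC)

theorem HasFejerMean.add {g h : ℝ → ℂ} {m k : ℂ} (hg : HasFejerMean g m)
    (hh : HasFejerMean h k) : HasFejerMean (fun t => g t + h t) (m + k) where
  cont := hg.cont.add hh.cont
  bdd := by
    obtain ⟨C, hC⟩ := hg.bdd
    obtain ⟨C', hC'⟩ := hh.bdd
    exact ⟨C + C', fun t => (norm_add_le _ _).trans (add_le_add (hC t) (hC' t))⟩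
  lim := by
    refine (hg.lim.add hh.lim).congr' ?_
    filter_upwards [self_mem_nhdsWithin] with c hc
    rw [← MeasureTheory.integral_add (integrable_fejer_mul hc hg.cont hg.bdd)
      (integrable_fejer_mul hc hh.cont hh.bdd)]
    simp_rw [mul_add]

theorem HasFejerMean.const_mul {g : ℝ → ℂ} {m : ℂ} (hg : HasFejerMean g m) (u : ℂ) :
    HasFejerMean (fun t => u * g t) (u * m) where
  cont := hg.cont.const_mul u
  bdd := by
    obtain ⟨C, hC⟩ := hg.bdd
    exact ⟨‖u‖ * C, fun t => by
      rw [norm_mul]; exact mul_le_mul_of_nonneg_left (hC t) (norm_nonneg u)⟩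
  lim := by
    refine (hg.lim.const_mul u).congr fun c => ?_
    rw [← MeasureTheory.integral_const_mul]
    congr 1; funext t; ring

theorem HasFejerMean.sum {ι : Type*} (s : Finset ι) {g : ι → ℝ → ℂ} {m : ι → ℂ}
    (h : ∀ i ∈ s, HasFejerMean (g i) (m i)) :
    HasFejerMean (fun t => ∑ i ∈ s, g i t) (∑ i ∈ s, m i) := by
  classical
  induction s using Finset.induction_on with
  | empty =>
    refine ⟨by simpa using continuous_const, ⟨0, by simp⟩, ?_⟩
    simp
  | insert i s hi ih =>
    simp only [Finset.sum_insert hi]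
    exact (h i (Finset.mem_insert_self i s)).add
      (ih fun j hj => h j (Finset.mem_insert_of_mem hj))

theorem integral_fejer_mul_exp {c : ℝ} (hc : 0 < c) (x : ℝ) :
    ∫ t : ℝ, ((c / (2 * Real.pi) : ℝ) : ℂ) * fejer (c * t) *
      Complex.exp (-(x : ℂ) * (t * Complex.I)) = tent (x / c) := by
  have h : kernelHat (fun t => ((c / (2 * Real.pi) : ℝ) : ℂ) * fejer (c * t)) x
      = tent (x / c) := by
    rw [kernelHat_const_mul, kernelHat_comp_mul _ hc, kernelHat_fejer]
    have h1 : (c : ℂ) ≠ 0 := by exact_mod_cast hc.ne'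
    have h2 : (Real.pi : ℂ) ≠ 0 := by exact_mod_cast Real.pi_ne_zero
    push_cast
    field_simp
  exact h

/-- The Fejér average at scale `c` is `tent (x / c)`: constantly `1` for `x = 0`, and `0` as soon as
`c ≤ |x|`. -/
theorem hasFejerMean_exp (x : ℝ) :
    HasFejerMean (fun t : ℝ => Complex.exp (-(x : ℂ) * (t * Complex.I)))
      (if x = 0 then 1 else 0) where
  cont := by fun_prop
  bdd := ⟨1, fun t => (norm_exp_neg_mul_ofReal_mul_I x t).le⟩
  lim := by
    refine tendsto_const_nhds.congr' ?_
    split_ifs with hx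
    · filter_upwards [self_mem_nhdsWithin] with c hc
      rw [integral_fejer_mul_exp hc, hx]
      simp [tent]
    · have hlt : ∀ᶠ c : ℝ in 𝓝[>] 0, c < |x| :=
        nhdsWithin_le_nhds (eventually_lt_nhds (abs_pos.2 hx))
      filter_upwards [self_mem_nhdsWithin, hlt] with c hc hcx
      have hc' : 0 < c := hc
      rw [integral_fejer_mul_exp hc, tent_of_one_le_abs]
      rw [abs_div, abs_of_pos hc', one_le_div hc']
      exact hcx.le

/-- The Fejér kernel is nonnegative, so each average, and hence the mean, respects domination. -/
theorem HasFejerMean.norm_le_of_norm_le {g h : ℝ → ℂ} {m k : ℂ} (hg : HasFejerMean g m)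
    (hh : HasFejerMean h k) {M : ℝ} (hle : ∀ t, ‖g t‖ ≤ M * ‖h t‖)
    (hpos : ∀ t, h t = (‖h t‖ : ℂ)) : ‖m‖ ≤ M * ‖k‖ := by
  refine le_of_tendsto_of_tendsto hg.lim.norm (hh.lim.norm.const_mul M) ?_
  filter_upwards [self_mem_nhdsWithin] with c hc
  have hc' : 0 < c := hc
  have hμ : ∀ t, ((c / (2 * Real.pi) : ℝ) : ℂ) * fejer (c * t)
      = (‖((c / (2 * Real.pi) : ℝ) : ℂ) * fejer (c * t)‖ : ℂ) := by
    intro t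
    rw [norm_mul, Complex.norm_of_nonneg (by positivity), Complex.ofReal_mul, ← fejer_eq_norm]
  have hi := integrable_fejer_mul hc' hh.cont hh.bdd
  have e : ∫ t, ((c / (2 * Real.pi) : ℝ) : ℂ) * fejer (c * t) * h t
      = ((∫ t, ‖((c / (2 * Real.pi) : ℝ) : ℂ) * fejer (c * t) * h t‖ : ℝ) : ℂ) := by
    rw [← integral_complex_ofReal]
    congr 1; funext t
    rw [norm_mul _ (h t), Complex.ofReal_mul, ← hμ, ← hpos]
  rw [e, Complex.norm_of_nonneg (MeasureTheory.integral_nonneg fun t => norm_nonneg _),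
    ← MeasureTheory.integral_const_mul]
  refine MeasureTheory.norm_integral_le_of_norm_le (hi.norm.const_mul M)
    (Eventually.of_forall fun t => ?_)
  rw [norm_mul, norm_mul _ (h t)]
  calc _ ≤ ‖((c / (2 * Real.pi) : ℝ) : ℂ) * fejer (c * t)‖ * (M * ‖h t‖) :=
        mul_le_mul_of_nonneg_left (hle t) (norm_nonneg _)
    _ = _ := by ring

/-! ### Riesz products -/

/-- The Riesz product `∏ (1 + Re (uₙ exp (i λₙ t)))`. -/
noncomputable def rieszProduct (l : ℕ → ℝ) (u : ℕ → ℂ) (N : ℕ) (t : ℝ) : ℂ :=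
  ∏ n ∈ Finset.range N, ((1 + (u n * Complex.exp (l n * (t * Complex.I))).re : ℝ) : ℂ)

theorem rieszProduct_eq_norm (l : ℕ → ℝ) {u : ℕ → ℂ} (hu : ∀ n, ‖u n‖ = 1) (N : ℕ) (t : ℝ) :
    rieszProduct l u N t = (‖rieszProduct l u N t‖ : ℂ) := by
  rw [rieszProduct, ← Complex.ofReal_prod, Complex.norm_of_nonneg]
  refine Finset.prod_nonneg fun n _ => ?_
  have h1 : ‖u n * Complex.exp (l n * (t * Complex.I))‖ = 1 := by
    have := norm_exp_neg_mul_ofReal_mul_I (-l n) t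
    rw [Complex.ofReal_neg, neg_neg] at this
    rw [norm_mul, hu, this, one_mul]
  have h2 := Complex.abs_re_le_norm (u n * Complex.exp (l n * (t * Complex.I)))
  rw [h1] at h2
  linarith [(abs_le.1 h2).1]

/-- Writing the real part as half of `z` plus its conjugate, a new factor only mixes the frequency
`x` with `x - l N` and `x + l N`. -/
theorem exp_mul_rieszProduct_succ (l : ℕ → ℝ) (u : ℕ → ℂ) (N : ℕ) (x t : ℝ) :
    Complex.exp (-(x : ℂ) * (t * Complex.I)) * rieszProduct l u (N + 1) t
      = Complex.exp (-(x : ℂ) * (t * Complex.I)) * rieszProduct l u N t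
        + u N / 2 * (Complex.exp (-((x - l N : ℝ) : ℂ) * (t * Complex.I)) * rieszProduct l u N t)
        + (starRingEnd ℂ) (u N) / 2 *
          (Complex.exp (-((x + l N : ℝ) : ℂ) * (t * Complex.I)) * rieszProduct l u N t) := by
  have h1 : Complex.exp (-((x - l N : ℝ) : ℂ) * (t * Complex.I))
      = Complex.exp (-(x : ℂ) * (t * Complex.I)) * Complex.exp (l N * (t * Complex.I)) := by
    rw [← Complex.exp_add]; congr 1; push_cast; ring
  have h2 : Complex.exp (-((x + l N : ℝ) : ℂ) * (t * Complex.I))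
      = Complex.exp (-(x : ℂ) * (t * Complex.I)) *
        (starRingEnd ℂ) (Complex.exp (l N * (t * Complex.I))) := by
    rw [← Complex.exp_conj, ← Complex.exp_add]; congr 1; simp; ring
  rw [rieszProduct, Finset.prod_range_succ, ← rieszProduct, h1, h2, Complex.ofReal_add,
    Complex.re_eq_add_conj, map_mul, Complex.ofReal_one]
  ring

/-- The first clause carries the induction: `l N` is outside the span of the earlier frequencies, so
shifting a point of that span by `± l N` leaves it and contributes mean `0`. -/
theorem hasFejerMean_rieszProduct {l : ℕ → ℝ} (hl : LinearIndependent ℚ l) (u : ℕ → ℂ) (N : ℕ) :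
    (∀ x : ℝ, x ∉ Submodule.span ℚ (l '' Set.Iio N) →
      HasFejerMean (fun t => Complex.exp (-(x : ℂ) * (t * Complex.I)) * rieszProduct l u N t) 0) ∧
    HasFejerMean (fun t => Complex.exp (-((0 : ℝ) : ℂ) * (t * Complex.I)) *
      rieszProduct l u N t) 1 ∧
    ∀ n < N, HasFejerMean (fun t => Complex.exp (-(l n : ℂ) * (t * Complex.I)) *
      rieszProduct l u N t) (u n / 2) := by
  induction N with
  | zero =>
    refine ⟨fun x hx => ?_, ?_, fun n hn => absurd hn (Nat.not_lt_zero n)⟩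
    · have hx0 : x ≠ 0 := fun h => hx (h ▸ Submodule.zero_mem _)
      have := hasFejerMean_exp x
      simpa [rieszProduct, hx0] using this
    · have := hasFejerMean_exp 0
      simpa [rieszProduct] using this
  | succ N ih =>
    obtain ⟨ih0, ih1, ihn⟩ := ih
    set W := Submodule.span ℚ (l '' Set.Iio N) with hW
    have hN : l N ∉ W := hl.notMem_span_image (by simp)
    have hmono : W ≤ Submodule.span ℚ (l '' Set.Iio (N + 1)) :=
      Submodule.span_mono (Set.image_mono (Set.Iio_subset_Iio (Nat.le_succ N)))
    have hmem : l N ∈ Submodule.span ℚ (l '' Set.Iio (N + 1)) :=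
      Submodule.subset_span ⟨N, Nat.lt_succ_self N, rfl⟩
    have step : ∀ {x : ℝ} {p q r : ℂ},
        HasFejerMean (fun t => Complex.exp (-(x : ℂ) * (t * Complex.I)) *
          rieszProduct l u N t) p →
        HasFejerMean (fun t => Complex.exp (-((x - l N : ℝ) : ℂ) * (t * Complex.I)) *
          rieszProduct l u N t) q →
        HasFejerMean (fun t => Complex.exp (-((x + l N : ℝ) : ℂ) * (t * Complex.I)) *
          rieszProduct l u N t) r →
        HasFejerMean (fun t => Complex.exp (-(x : ℂ) * (t * Complex.I)) *
          rieszProduct l u (N + 1) t) (p + u N / 2 * q + (starRingEnd ℂ) (u N) / 2 * r) := by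
      intro x p q r hp hq hr
      simp_rw [exp_mul_rieszProduct_succ]
      exact (hp.add (hq.const_mul _)).add (hr.const_mul _)
    refine ⟨fun x hx => ?_, ?_, fun n hn => ?_⟩
    · have h1 : x ∉ W := fun h => hx (hmono h)
      have h2 : x - l N ∉ W := fun h => hx (by
        have := Submodule.add_mem _ (hmono h) hmem
        rwa [sub_add_cancel] at this)
      have h3 : x + l N ∉ W := fun h => hx (by
        have := Submodule.sub_mem _ (hmono h) hmem
        rwa [add_sub_cancel_right] at this)
      simpa using step (ih0 x h1) (ih0 _ h2) (ih0 _ h3)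
    · have h2 : (0 : ℝ) - l N ∉ W := fun h => hN (by simpa using W.neg_mem h)
      have h3 : (0 : ℝ) + l N ∉ W := by rwa [zero_add]
      simpa using step ih1 (ih0 _ h2) (ih0 _ h3)
    · rcases (Nat.lt_succ_iff_lt_or_eq.1 hn) with hlt | rfl
      · have hnW : l n ∈ W := Submodule.subset_span ⟨n, hlt, rfl⟩
        have h2 : l n - l N ∉ W := fun h => hN (by
          have := W.sub_mem hnW h
          rwa [sub_sub_cancel] at this)
        have h3 : l n + l N ∉ W := fun h => hN (by
          have := W.sub_mem h hnW
          rwa [add_sub_cancel_left] at this)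
        simpa using step (ihn n hlt) (ih0 _ h2) (ih0 _ h3)
      -- At the new frequency itself, the shift down hits `0` and yields `u n / 2`; the shift up
      -- stays outside since a rational subspace containing `2 * l n` contains `l n`.
      · have h3 : l n + l n ∉ W := fun h => hN (by
          have := W.smul_mem (1 / 2 : ℚ) h
          rwa [← two_smul ℚ (l n), smul_smul, show (1 / 2 : ℚ) * 2 = 1 by norm_num,
            one_smul] at this)
        have h1 := ih1
        rw [← sub_self (l n)] at h1
        simpa using step (ih0 _ hN) h1 (ih0 _ h3)

/-- The coefficient sum of a trigonometric polynomial with `ℚ`-independent frequencies is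
controlled by its supremum. -/
theorem sum_norm_le_of_linearIndependent {l : ℕ → ℝ} (hl : LinearIndependent ℚ l) (c : ℕ → ℂ)
    (N : ℕ) {M : ℝ}
    (hM : ∀ t : ℝ, ‖∑ n ∈ Finset.range N, c n * Complex.exp (-(l n : ℂ) * (t * Complex.I))‖ ≤ M) :
    ∑ n ∈ Finset.range N, ‖c n‖ ≤ 2 * M := by
  have hphase : ∀ z : ℂ, ∃ w : ℂ, ‖w‖ = 1 ∧ z * w = ‖z‖ := by
    intro z
    rcases eq_or_ne z 0 with rfl | hz
    · exact ⟨1, by simp, by simp⟩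
    · have hz' : (‖z‖ : ℂ) ≠ 0 := by exact_mod_cast (norm_ne_zero_iff.2 hz)
      refine ⟨(‖z‖ : ℂ) / z, ?_, mul_div_cancel₀ _ hz⟩
      rw [norm_div, Complex.norm_real, norm_norm, div_self (norm_ne_zero_iff.2 hz)]
  choose w hw1 hw2 using hphase
  -- With these phases the mean of polynomial times Riesz product is half the sum of the `‖c n‖`,
  -- while the nonnegative product has mean `1`, so this mean is at most `M`.
  set u : ℕ → ℂ := fun n => w (c n) with hu
  obtain ⟨-, h1, hn⟩ := hasFejerMean_rieszProduct hl u N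
  have hsum := HasFejerMean.sum (Finset.range N) (fun n hn' =>
    (hn n (Finset.mem_range.1 hn')).const_mul (c n))
  have hval : ∑ n ∈ Finset.range N, c n * (u n / 2)
      = ((∑ n ∈ Finset.range N, ‖c n‖ / 2 : ℝ) : ℂ) := by
    push_cast
    refine Finset.sum_congr rfl fun n _ => ?_
    rw [← mul_div_assoc, hw2]
  rw [hval] at hsum
  simp only [Complex.ofReal_zero, neg_zero, zero_mul, Complex.exp_zero, one_mul] at h1
  have key := hsum.norm_le_of_norm_le h1 (M := M) (fun t => ?_)
    (rieszProduct_eq_norm l (fun n => hw1 (c n)) N)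
  · rw [Complex.norm_of_nonneg (Finset.sum_nonneg fun n _ => by positivity), norm_one, mul_one,
      ← Finset.sum_div] at key
    linarith
  · have e : ∑ n ∈ Finset.range N, c n * (Complex.exp (-(l n : ℂ) * (t * Complex.I)) *
        rieszProduct l u N t)
        = (∑ n ∈ Finset.range N, c n * Complex.exp (-(l n : ℂ) * (t * Complex.I))) *
          rieszProduct l u N t := by
      rw [Finset.sum_mul]
      exact Finset.sum_congr rfl fun n _ => (mul_assoc _ _ _).symm
    rw [e, norm_mul]
    exact mul_le_mul_of_nonneg_right (hM t) (norm_nonneg _)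

namespace Frequency

variable {lam : Frequency}

/-- For a `ℚ`-linearly independent frequency the coefficients are absolutely summable. -/
theorem DExt.sum_norm_coeff_le (hl : LinearIndependent ℚ lam.seq) (D : lam.DExt) (N : ℕ) :
    ∑ n ∈ Finset.range N, ‖D.coeff n‖ ≤ 2 * ‖D‖ := by
  set I : ℝ := ∫ t, ‖jackson t‖ with hI
  have hI0 : 0 < I := integral_norm_jackson_pos
  -- The dilated kernel truncates smoothly to frequencies below `2 * c`. The polynomial needs all of
  -- these, hence the range `max N N₀`; only the first `N` terms are kept afterwards.
  have hbound : ∀ c : ℝ, 0 < c → ∑ n ∈ Finset.range N,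
      ‖D.coeff n‖ * ‖kernelHat jackson (lam.seq n / c)‖ ≤ 2 * (‖D‖ * I) := by
    intro c hc
    obtain ⟨N₀, hN₀⟩ := (lam.tendsto_atTop.eventually_ge_atTop (2 * c)).exists_forall_of_atTop
    have hhat : ∀ x, kernelHat (fun t => jackson (c * t)) x
        = (c : ℂ)⁻¹ * kernelHat jackson (x / c) := kernelHat_comp_mul jackson hc
    have hzero : ∀ n, max N N₀ ≤ n → kernelHat (fun t => jackson (c * t)) (lam.seq n) = 0 := by
      intro n hn
      rw [hhat, kernelHat_jackson_of_two_le_abs, mul_zero]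
      rw [abs_div, abs_of_pos hc, le_div_iff₀ hc]
      exact (hN₀ n ((le_max_right _ _).trans hn)).trans (le_abs_self _)
    have hpoly : ∀ t : ℝ, ‖∑ n ∈ Finset.range (max N N₀),
        (D.coeff n * kernelHat (fun t => jackson (c * t)) (lam.seq n)) *
          Complex.exp (-(lam.seq n : ℂ) * (t * Complex.I))‖ ≤ ‖D‖ * (c⁻¹ * I) := by
      intro t
      rw [hI, ← integral_norm_jackson_comp_mul hc]
      exact D.ext_spec.norm_sum_mul_kernelHat_le (fun s hs => D.norm_ext_le hs)
        (integrable_jackson.comp_mul_left' hc.ne')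
        (D.ext_spec.dominated_of_integrable_weight (integrable_weight_jackson_comp_mul hc))
        hzero (by simp)
    have h1 := sum_norm_le_of_linearIndependent hl _ _ hpoly
    have h2 : ∑ n ∈ Finset.range N,
        ‖D.coeff n * kernelHat (fun t => jackson (c * t)) (lam.seq n)‖ ≤ 2 * (‖D‖ * (c⁻¹ * I)) :=
      (Finset.sum_le_sum_of_subset_of_nonneg (Finset.range_mono (le_max_left _ _))
        fun n _ _ => norm_nonneg _).trans h1
    have e : ∑ n ∈ Finset.range N,
        ‖D.coeff n * kernelHat (fun t => jackson (c * t)) (lam.seq n)‖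
        = c⁻¹ * ∑ n ∈ Finset.range N,
          ‖D.coeff n‖ * ‖kernelHat jackson (lam.seq n / c)‖ := by
      rw [Finset.mul_sum]
      refine Finset.sum_congr rfl fun n _ => ?_
      rw [hhat, norm_mul, norm_mul, norm_inv, Complex.norm_of_nonneg hc.le]
      ring
    rw [e] at h2
    refine le_of_mul_le_mul_left (h2.trans (le_of_eq ?_)) (inv_pos.2 hc)
    ring
  -- As `c → ∞` with `N` fixed, each weight tends to the transform at `0`, which is `I` and cancels.
  have hlim : Tendsto (fun c : ℝ => ∑ n ∈ Finset.range N,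
      ‖D.coeff n‖ * ‖kernelHat jackson (lam.seq n / c)‖) atTop
      (𝓝 (∑ n ∈ Finset.range N, ‖D.coeff n‖ * ‖kernelHat jackson 0‖)) := by
    refine tendsto_finsetSum _ fun n _ => Tendsto.const_mul _ ?_
    exact ((continuous_kernelHat_jackson.tendsto 0).comp
      (tendsto_const_nhds.div_atTop tendsto_id)).norm
  have hle := le_of_tendsto hlim ((eventually_gt_atTop 0).mono hbound)
  rw [← Finset.sum_mul, kernelHat_zero_eq_integral_norm jackson_eq_norm,
    Complex.norm_of_nonneg hI0.le, ← mul_assoc] at hle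
  exact le_of_mul_le_mul_right hle hI0

theorem completeSpace_dExt_of_linearIndependent (hl : LinearIndependent ℚ lam.seq) :
    CompleteSpace lam.DExt :=
  completeSpace_dExt_of_sum_le (σ := 0) (C := 2) le_rfl fun D N => by
    simpa using D.sum_norm_coeff_le hl N

theorem completeSpace_dInf_of_linearIndependent (hl : LinearIndependent ℚ lam.seq) :
    CompleteSpace lam.DInf := by
  refine completeSpace_dInf_of_forall_convergesAt (completeSpace_dExt_of_linearIndependent hl)
    fun D s hs => ⟨_, tendsto_partialSum_of_summable (σ := 0) ?_ hs.le⟩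
  refine summable_of_sum_range_le (c := 2 * ‖D‖) (fun n => by positivity) fun N => ?_
  simpa using D.sum_norm_coeff_le hl N

end Frequency

/-! ### Examples -/

namespace Frequency

/-- The integers `k`, each accompanied by the point `k + exp (-exp (k ^ 2))`. -/
noncomputable def closePairsSeq (n : ℕ) : ℝ :=
  (n / 2 : ℕ) + if n % 2 = 1 then Real.exp (-Real.exp (((n / 2 : ℕ) : ℝ) ^ 2)) else 0

theorem closePairsSeq_even (k : ℕ) : closePairsSeq (2 * k) = k := by
  simp [closePairsSeq]

theorem closePairsSeq_odd (k : ℕ) :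
    closePairsSeq (2 * k + 1) = k + Real.exp (-Real.exp ((k : ℝ) ^ 2)) := by
  have h1 : (2 * k + 1) / 2 = k := by omega
  have h2 : (2 * k + 1) % 2 = 1 := by omega
  simp [closePairsSeq, h1, h2]

theorem div_two_le_closePairsSeq (n : ℕ) : ((n / 2 : ℕ) : ℝ) ≤ closePairsSeq n := by
  rw [closePairsSeq]
  split_ifs
  · linarith [Real.exp_pos (-Real.exp (((n / 2 : ℕ) : ℝ) ^ 2))]
  · simp

theorem strictMono_closePairsSeq : StrictMono closePairsSeq := by
  refine strictMono_nat_of_lt_succ fun n => ?_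
  rcases Nat.even_or_odd' n with ⟨k, rfl | rfl⟩
  · rw [closePairsSeq_even, closePairsSeq_odd]
    linarith [Real.exp_pos (-Real.exp ((k : ℝ) ^ 2))]
  · rw [closePairsSeq_odd, show 2 * k + 1 + 1 = 2 * (k + 1) by ring, closePairsSeq_even]
    have : Real.exp (-Real.exp ((k : ℝ) ^ 2)) < 1 :=
      Real.exp_lt_one_iff.2 (neg_lt_zero.2 (Real.exp_pos _))
    push_cast
    linarith

theorem tendsto_natCast_div_two_atTop :
    Tendsto (fun n : ℕ => ((n / 2 : ℕ) : ℝ)) atTop atTop :=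
  tendsto_natCast_atTop_atTop.comp (Nat.tendsto_div_const_atTop two_ne_zero)

/-- A frequency of linear growth which violates Landau's condition. -/
noncomputable def closePairs : Frequency where
  seq := closePairsSeq
  strictMono := strictMono_closePairsSeq
  nonneg n := (Nat.cast_nonneg _).trans (div_two_le_closePairsSeq n)
  tendsto_atTop := tendsto_atTop_mono div_two_le_closePairsSeq tendsto_natCast_div_two_atTop

theorem closePairs_L : closePairs.L = 0 := by
  have hlog : Tendsto (fun N : ℕ => 4 * (Real.log ((N : ℝ) + 1) / ((N : ℝ) + 1))) atTop (𝓝 0) := by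
    have h1 : Tendsto (fun x : ℝ => Real.log x / x) atTop (𝓝 0) :=
      Real.isLittleO_log_id_atTop.tendsto_div_nhds_zero
    have h2 : Tendsto (fun N : ℕ => (N : ℝ) + 1) atTop atTop :=
      tendsto_atTop_add_const_right _ _ tendsto_natCast_atTop_atTop
    simpa using (h1.comp h2).const_mul 4
  have h : Tendsto (fun N : ℕ => Real.log ((N : ℝ) + 1) / closePairs.seq N) atTop (𝓝 0) := by
    refine tendsto_of_tendsto_of_tendsto_of_le_of_le' tendsto_const_nhds hlog ?_ ?_
    · exact Eventually.of_forall fun N =>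
        div_nonneg (Real.log_nonneg (by linarith [Nat.cast_nonneg (α := ℝ) N]))
          (closePairs.nonneg N)
    · filter_upwards [eventually_ge_atTop 3] with N hN
      have h1 : ((N : ℝ) + 1) / 4 ≤ closePairs.seq N := by
        refine le_trans ?_ (div_two_le_closePairsSeq N)
        have h2 : N + 1 ≤ 4 * (N / 2) := by omega
        have h3 : ((N : ℝ) + 1) ≤ 4 * ((N / 2 : ℕ) : ℝ) := by exact_mod_cast h2
        linarith
      have hlog0 : 0 ≤ Real.log ((N : ℝ) + 1) :=
        Real.log_nonneg (by linarith [Nat.cast_nonneg (α := ℝ) N])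
      calc Real.log ((N : ℝ) + 1) / closePairs.seq N
          ≤ Real.log ((N : ℝ) + 1) / (((N : ℝ) + 1) / 4) :=
            div_le_div_of_nonneg_left hlog0 (by positivity) h1
        _ = _ := by field_simp
  have h' : Tendsto (fun N : ℕ => ((Real.log ((N : ℝ) + 1) / closePairs.seq N : ℝ) : EReal))
      atTop (𝓝 ((0 : ℝ) : EReal)) := (continuous_coe_real_ereal.tendsto 0).comp h
  exact h'.limsup_eq

/-- Already `δ = 1` fails: `exp (k ^ 2) ≥ k + exp k` for `k ≥ 2`, so the gap after `k` would force
`C ≤ exp (-k)` for all such `k`. -/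
theorem not_LC_closePairs : ¬ closePairs.LC := by
  intro h
  obtain ⟨C, hC, hgap⟩ := h 1 one_pos
  have hlim : Tendsto (fun k : ℕ => Real.exp (-(k : ℝ))) atTop (𝓝 0) :=
    Real.tendsto_exp_neg_atTop_nhds_zero.comp tendsto_natCast_atTop_atTop
  obtain ⟨k, hk, hk2⟩ := ((hlim.eventually_lt_const hC).and (eventually_ge_atTop 2)).exists
  have hk2' : (2 : ℝ) ≤ k := by exact_mod_cast hk2
  have h1 : C * Real.exp (-Real.exp (1 * closePairsSeq (2 * k)))
      ≤ closePairsSeq (2 * k + 1) - closePairsSeq (2 * k) := hgap (2 * k)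
  rw [closePairsSeq_even, closePairsSeq_odd, one_mul, add_sub_cancel_left] at h1
  have hE : (k : ℝ) + 1 ≤ Real.exp k := Real.add_one_le_exp _
  have h2 : 2 * Real.exp k ≤ Real.exp ((k : ℝ) ^ 2) := by
    have h3 : Real.exp (k : ℝ) * Real.exp k ≤ Real.exp ((k : ℝ) ^ 2) := by
      rw [← Real.exp_add]
      exact Real.exp_le_exp.2 (by nlinarith)
    nlinarith [Real.exp_pos (k : ℝ)]
  have h4 : Real.exp (-Real.exp ((k : ℝ) ^ 2))
      ≤ Real.exp (-(k : ℝ)) * Real.exp (-Real.exp (k : ℝ)) := by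
    rw [← Real.exp_add]
    exact Real.exp_le_exp.2 (by linarith)
  have h5 := le_of_mul_le_mul_right (h1.trans h4) (Real.exp_pos _)
  linarith

theorem not_linearIndependent_closePairs : ¬ LinearIndependent ℚ closePairs.seq := by
  intro h
  -- The sequence starts with the frequency `0`.
  refine h.ne_zero 0 ?_
  change closePairsSeq (2 * 0) = 0
  rw [closePairsSeq_even, Nat.cast_zero]

/-! ### An independent frequency with `L = ⊤` -/

theorem exists_linearIndependent_nat : ∃ b : ℕ → ℝ, LinearIndependent ℚ b := by
  let B := Module.Basis.ofVectorSpace ℚ ℝ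
  have hinf : Infinite (Module.Basis.ofVectorSpaceIndex ℚ ℝ) := by
    rw [Cardinal.infinite_iff, B.mk_eq_rank'', Real.rank_rat_real]
    exact Cardinal.aleph0_le_continuum
  exact ⟨fun n => B (Infinite.natEmbedding _ n),
    B.linearIndependent.comp _ (Infinite.natEmbedding _).injective⟩

/-- Nonzero rational multiples preserve independence, so each independent vector can be moved into a
prescribed interval. -/
theorem exists_rat_mul_mem_Ioo {x p q : ℝ} (hx : x ≠ 0) (hpq : p < q) (hp : 0 ≤ p) :
    ∃ r : ℚ, r ≠ 0 ∧ p < r * x ∧ r * x < q := by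
  have hx' : 0 < |x| := abs_pos.2 hx
  obtain ⟨r, hr1, hr2⟩ := exists_rat_btwn (div_lt_div_of_pos_right hpq hx')
  rw [div_lt_iff₀ hx'] at hr1
  rw [lt_div_iff₀ hx'] at hr2
  have hr0 : r ≠ 0 := by
    rintro rfl
    simp at hr1
    linarith
  rcases abs_choice x with h | h
  · rw [h] at hr1 hr2
    exact ⟨r, hr0, hr1, hr2⟩
  · rw [h] at hr1 hr2
    refine ⟨-r, neg_ne_zero.2 hr0, ?_, ?_⟩ <;> push_cast <;> linarith

theorem tendsto_sqrt_log_natCast :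
    Tendsto (fun n : ℕ => Real.sqrt (Real.log ((n : ℝ) + 1))) atTop atTop :=
  Real.tendsto_sqrt_atTop.comp (Real.tendsto_log_atTop.comp
    (tendsto_atTop_add_const_right _ _ tendsto_natCast_atTop_atTop))

theorem exists_linearIndependent_frequency_L_eq_top :
    ∃ lam : Frequency, LinearIndependent ℚ lam.seq ∧ lam.L = ⊤ := by
  obtain ⟨b, hb⟩ := exists_linearIndependent_nat
  set g : ℕ → ℝ := fun n => Real.sqrt (Real.log ((n : ℝ) + 1)) with hg
  have hglt : ∀ n, g n < g (n + 1) := by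
    intro n
    have hn : (0 : ℝ) ≤ n := Nat.cast_nonneg n
    refine Real.sqrt_lt_sqrt (Real.log_nonneg (by linarith)) (Real.log_lt_log (by positivity) ?_)
    push_cast
    linarith
  choose r hr0 hr1 hr2 using fun n =>
    exists_rat_mul_mem_Ioo (hb.ne_zero n) (hglt n) (Real.sqrt_nonneg _)
  let lam : Frequency :=
    { seq := fun n => r n * b n
      strictMono := strictMono_nat_of_lt_succ fun n => (hr2 n).trans (hr1 (n + 1))
      nonneg := fun n => (Real.sqrt_nonneg _).trans (hr1 n).le
      tendsto_atTop := tendsto_atTop_mono (fun n => (hr1 n).le) tendsto_sqrt_log_natCast }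
  refine ⟨lam, ?_, ?_⟩
  · have h := hb.units_smul fun n => Units.mk0 (r n) (hr0 n)
    have e : (fun n => Units.mk0 (r n) (hr0 n)) • b = lam.seq := by
      funext n
      simp [lam, Units.smul_def, Rat.smul_def]
    rwa [e] at h
  · have hle : ∀ᶠ N : ℕ in atTop,
        2⁻¹ * g N ≤ Real.log ((N : ℝ) + 1) / lam.seq N := by
      filter_upwards [eventually_ge_atTop 1] with N hN
      have hN' : (1 : ℝ) ≤ N := by exact_mod_cast hN
      have hlog : 0 ≤ Real.log ((N : ℝ) + 1) := Real.log_nonneg (by linarith)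
      have hpos : 0 < lam.seq N := (Real.sqrt_nonneg _).trans_lt (hr1 N)
      -- From `N + 2 ≤ (N + 1) ^ 2`; the constant is weakened to a square so that the root gives `g
      -- (N + 1) ≤ 2 * g N`.
      have hlog2 : Real.log (((N + 1 : ℕ) : ℝ) + 1) ≤ 2 ^ 2 * Real.log ((N : ℝ) + 1) := by
        have h1 : Real.log (((N + 1 : ℕ) : ℝ) + 1) ≤ Real.log (((N : ℝ) + 1) ^ 2) := by
          refine Real.log_le_log (by positivity) ?_
          push_cast
          nlinarith
        rw [Real.log_pow] at h1
        push_cast at h1 ⊢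
        linarith
      have hg2 : g (N + 1) ≤ 2 * g N := by
        have := Real.sqrt_le_sqrt hlog2
        rwa [Real.sqrt_mul (by norm_num), Real.sqrt_sq (by norm_num)] at this
      rw [le_div_iff₀ hpos]
      have h1 : lam.seq N ≤ 2 * g N := (hr2 N).le.trans hg2
      have h2 : g N * g N = Real.log ((N : ℝ) + 1) := Real.mul_self_sqrt hlog
      have h3 := mul_le_mul_of_nonneg_left h1 (show 0 ≤ 2⁻¹ * g N by positivity)
      linarith
    have hto : Tendsto (fun N : ℕ => Real.log ((N : ℝ) + 1) / lam.seq N) atTop atTop :=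
      tendsto_atTop_mono' _ hle (tendsto_sqrt_log_natCast.const_mul_atTop (by norm_num))
    exact (EReal.tendsto_coe_nhds_top_iff.2 hto).limsup_eq

end Frequency

/-- Completeness of `D_∞^ext(λ)` and `D_∞(λ)`; both are normed spaces over `ℂ`, so `CompleteSpace`
says that they are Banach spaces. -/
theorem theorem5p1 :
    -- sufficient conditions
    (∀ lam : Frequency,
      (lam.L < ⊤ → CompleteSpace lam.DExt) ∧
      (LinearIndependent ℚ lam.seq → CompleteSpace lam.DInf) ∧
      (lam.L = 0 → CompleteSpace lam.DInf) ∧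
      (lam.ConvergesWhereExtendable ∧ lam.L < ⊤ → CompleteSpace lam.DInf) ∧
      (lam.BC → (lam.ConvergesWhereExtendable ∧ lam.L < ⊤) ∧ CompleteSpace lam.DInf) ∧
      (lam.LC ∧ lam.L < ⊤ →
        (lam.ConvergesWhereExtendable ∧ lam.L < ⊤) ∧ CompleteSpace lam.DInf)) ∧
    -- none of the conditions is necessary
    (∃ lam : Frequency, CompleteSpace lam.DExt ∧ ¬ lam.L < ⊤) ∧
    (∃ lam : Frequency, CompleteSpace lam.DInf ∧ ¬ LinearIndependent ℚ lam.seq) ∧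
    (∃ lam : Frequency, CompleteSpace lam.DInf ∧ ¬ lam.L = 0) ∧
    (∃ lam : Frequency, CompleteSpace lam.DInf ∧
      ¬ (lam.ConvergesWhereExtendable ∧ lam.L < ⊤)) ∧
    (∃ lam : Frequency, CompleteSpace lam.DInf ∧ ¬ lam.L < ⊤) ∧
    (∃ lam : Frequency, CompleteSpace lam.DInf ∧ ¬ lam.BC) ∧
    (∃ lam : Frequency, CompleteSpace lam.DInf ∧ ¬ (lam.LC ∧ lam.L < ⊤)) ∧
    (∃ lam : Frequency, CompleteSpace lam.DInf ∧ ¬ lam.LC) := by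
  have hLC : ∀ lam : Frequency, lam.LC ∧ lam.L < ⊤ →
      (lam.ConvergesWhereExtendable ∧ lam.L < ⊤) ∧ CompleteSpace lam.DInf := fun lam h =>
    have hc := h.1.convergesWhereExtendable h.2
    ⟨⟨hc, h.2⟩, Frequency.completeSpace_dInf_of_convergesWhereExtendable hc h.2⟩
  refine ⟨fun lam => ⟨Frequency.completeSpace_dExt_of_L_lt_top,
    Frequency.completeSpace_dInf_of_linearIndependent,
    Frequency.completeSpace_dInf_of_L_eq_zero,
    fun h => Frequency.completeSpace_dInf_of_convergesWhereExtendable h.1 h.2,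
    fun h => hLC lam ⟨h.LC, h.L_lt_top⟩, hLC lam⟩, ?_⟩
  -- This frequency violates every condition that entails `L < ⊤`; `closePairs`, complete because `L
  -- = 0`, handles independence and (LC).
  obtain ⟨lam, hind, hL⟩ := Frequency.exists_linearIndependent_frequency_L_eq_top
  have hL' : ¬ lam.L < ⊤ := by simp [hL]
  have hinf := Frequency.completeSpace_dInf_of_linearIndependent hind
  have hpairs := Frequency.completeSpace_dInf_of_L_eq_zero Frequency.closePairs_L
  exact ⟨⟨lam, Frequency.completeSpace_dExt_of_linearIndependent hind, hL'⟩,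
    ⟨_, hpairs, Frequency.not_linearIndependent_closePairs⟩,
    ⟨lam, hinf, by simp [hL]⟩, ⟨lam, hinf, fun h => hL' h.2⟩, ⟨lam, hinf, hL'⟩,
    ⟨lam, hinf, fun h => hL' h.L_lt_top⟩, ⟨lam, hinf, fun h => hL' h.2⟩,
    ⟨_, hpairs, Frequency.not_LC_closePairs⟩⟩
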